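/- All graphs are finite and simple. A bridgeless cubic graph means here a connected graph in which every vertex has degree $3$ and no edge is a bridge. An FR-triple of such a graph $G$ is a list $(M_1,M_2,M_3)$ of three (not necessarily distinct) perfect matchings of $G$, regarded as sets of edges, with $M_1\cap M_2\cap M_3=\emptyset$; the frequency of an edge $e$ in it is the number of indices $s\in\{1,2,3\}$ with $e\in M_s$. Theorem. The following two statements are equivalent. (1) (Stronger Fan–Raspaud statement of Mkrtchyan and Vardanyan) For every bridgeless cubic graph $G$, every vertex $w$ of $G$, every ordering $(a,b,c)$ of the three edges incident to $w$, and all $i,j,k\in\{0,1,2\}$ with $i+j+k=3$, there is an FR-triple of $G$ in which $a$, $b$, $c$ have frequencies $i$, $j$, $k$, respectively. (2) (Fan–Raspaud Conjecture) Every bridgeless cubic graph has an FR-triple. -/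

import Mathlib

universe u

namespace FanRaspaud

/-- A (simple) graph that is connected, cubic and has no bridge. -/
structure IsBridgelessCubic {V : Type u} (G : SimpleGraph V) [G.LocallyFinite] : Prop where
  connected : G.Connected
  cubic : G.IsRegularOfDegree 3
  bridgeless : ∀ e ∈ G.edgeSet, ¬ G.IsBridge e

/-- An FR-triple: a list of three perfect matchings, not necessarily distinct, such that no edge
belongs to all three. -/
def IsFRTriple {V : Type u} {G : SimpleGraph V} (M : Fin 3 → G.Subgraph) : Prop :=
  (∀ s, (M s).IsPerfectMatching) ∧ (M 0).edgeSet ∩ (M 1).edgeSet ∩ (M 2).edgeSet = ∅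

/-- The frequency of the edge `a` in the list `M`: the number of indices `s` such that `a` is an
edge of `M s`. -/
noncomputable def frequency {V : Type u} {G : SimpleGraph V} {t : ℕ} (M : Fin t → G.Subgraph)
    (a : Sym2 V) : ℕ :=
  {s : Fin t | a ∈ (M s).edgeSet}.ncard

/-- The Fan-Raspaud Conjecture: every finite simple connected bridgeless cubic graph has an
FR-triple. -/
def FanRaspaudConjecture : Prop :=
  ∀ (V : Type u) [Finite V] (G : SimpleGraph V) [G.LocallyFinite], IsBridgelessCubic G →
    ∃ M : Fin 3 → G.Subgraph, IsFRTriple M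

/-- The stronger statement of Mkrtchyan and Vardanyan: the frequencies of the three edges
`a`, `b`, `c` incident to a given vertex `w`, in any given order, can be prescribed. -/
def StrongFanRaspaudConjecture : Prop :=
  ∀ (V : Type u) [Finite V] (G : SimpleGraph V) [G.LocallyFinite], IsBridgelessCubic G →
    ∀ (w : V) (a b c : Sym2 V), a ∈ G.incidenceSet w → b ∈ G.incidenceSet w →
      c ∈ G.incidenceSet w → a ≠ b → a ≠ c → b ≠ c →
    ∀ i j k : ℕ, i ∈ ({0, 1, 2} : Set ℕ) → j ∈ ({0, 1, 2} : Set ℕ) → k ∈ ({0, 1, 2} : Set ℕ) →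
      i + j + k = 3 →
    ∃ M : Fin 3 → G.Subgraph, IsFRTriple M ∧
      frequency M a = i ∧ frequency M b = j ∧ frequency M c = k

end FanRaspaud

/-! Only the passage from the conjecture to the stronger statement needs work. Frequencies at a
vertex are at most 2 and sum to 3, so they are 1, 1, 1 or a permutation of 0, 1, 2. Each pattern is
obtained by gluing cubic graphs together and applying the conjecture to the result.

An edge can be given frequency f for f = 0 and for f = 2 (`exists_freq_eq`). Otherwise, replace
every edge of the Petersen graph by a counterexample, via two-sums. A perfect matching contains both
or none of the edges of a two-edge cut, so an FR-triple of the large graph induces one of the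
Petersen graph in which no edge has frequency f. Then all frequencies are 1, which would make the
Petersen graph 3-edge-colourable.

Pattern 0, 1, 2 (`exists_freq_zero_one_two`): glue two copies of the graph at w by a three-sum with
two of the three ports crossed, and give the uncrossed cut edge frequency 0. The other two cut edges
have frequencies 1 and 2, and the two contractions show these in both orders.

Pattern 1, 1, 1 (`exists_freq_one`): otherwise, plant a counterexample at each of the four
neighbours of an edge of the Petersen graph, and give that edge frequency 2. A perfect matching
contains one or three edges of a three-edge cut, so contracting leaves joins: all degrees are odd,
and equal to one off the four vertices. `PetersenJoin.exists_all_one` finds one of the four at which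
all frequencies are 1, and the copy planted there inherits the forbidden pattern. -/

namespace FanRaspaud

open SimpleGraph

/-! ### Cubic graphs, joins and frequencies -/

/-- A labelling of the vertices that is constant along all edges but one is constant. -/
def TwoEdgeConnected {V : Type u} (G : SimpleGraph V) : Prop :=
  ∀ (e : Sym2 V) (f : V → Bool), (∀ x y, G.Adj x y → s(x, y) ≠ e → f x = f y) → ∀ x y, f x = f y

/-- `x` enumerates the neighbours of `v` without repetition. -/
def IsPorts {V : Type u} (G : SimpleGraph V) (v : V) (x : Fin 3 → V) : Prop :=
  Function.Injective x ∧ ∀ u, G.Adj v u ↔ ∃ i, x i = u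

/-- Bridgeless cubic graphs, without reference to local finiteness data. -/
structure IsCubic₂ {V : Type u} (G : SimpleGraph V) : Prop where
  nonempty : Nonempty V
  conn : TwoEdgeConnected G
  ports : ∀ v, ∃ x, IsPorts G v x

/-- Spanning subgraphs with all degrees odd, and equal to one outside `R`. -/
structure IsJoin {V : Type u} (G : SimpleGraph V) (R : Set V) (M : SimpleGraph V) : Prop where
  le : M ≤ G
  odd : ∀ v, Odd (M.neighborSet v).ncard
  one : ∀ v ∉ R, (M.neighborSet v).ncard = 1

/-- Three joins without a common edge. -/
structure IsTriple {V : Type u} (G : SimpleGraph V) (R : Set V) (M : Fin 3 → SimpleGraph V) :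
    Prop where
  join : ∀ s, IsJoin G R (M s)
  inter : ∀ x y, ¬ ∀ s, (M s).Adj x y

/-- The number of graphs in the list `M` in which `x` and `y` are adjacent. -/
noncomputable def freq {V : Type u} (M : Fin 3 → SimpleGraph V) (x y : V) : ℕ :=
  {s : Fin 3 | (M s).Adj x y}.ncard

open Classical in
theorem ncard_fin_three (P : Fin 3 → Prop) :
    {i | P i}.ncard = (if P 0 then 1 else 0) + (if P 1 then 1 else 0) + (if P 2 then 1 else 0) := by
  rw [Set.ncard_eq_toFinset_card', Set.toFinset_ofPred, Finset.card_filter, Fin.sum_univ_three]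

open Classical in
theorem freq_eq {V : Type u} (M : Fin 3 → SimpleGraph V) (x y : V) :
    freq M x y = (if (M 0).Adj x y then 1 else 0) + (if (M 1).Adj x y then 1 else 0) +
      (if (M 2).Adj x y then 1 else 0) :=
  ncard_fin_three _

theorem freq_comm {V : Type u} (M : Fin 3 → SimpleGraph V) (x y : V) :
    freq M x y = freq M y x := by
  simp only [freq, SimpleGraph.adj_comm]

open Classical in
theorem IsPorts.ncard_neighborSet {V : Type u} {G M : SimpleGraph V} {v : V} {x : Fin 3 → V}
    (hx : IsPorts G v x) (hM : M ≤ G) :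
    (M.neighborSet v).ncard = (if M.Adj v (x 0) then 1 else 0) + (if M.Adj v (x 1) then 1 else 0) +
      (if M.Adj v (x 2) then 1 else 0) := by
  rw [← ncard_fin_three (fun i => M.Adj v (x i)), ← Set.ncard_image_of_injective _ hx.1]
  congr 1
  ext u
  constructor
  · intro h
    obtain ⟨i, rfl⟩ := (hx.2 u).1 (hM h)
    exact ⟨i, h, rfl⟩
  · rintro ⟨i, h, rfl⟩
    exact h

theorem IsPorts.ncard {V : Type u} {G : SimpleGraph V} {v : V} {x : Fin 3 → V}
    (hx : IsPorts G v x) : (G.neighborSet v).ncard = 3 := by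
  have h : ∀ i, G.Adj v (x i) := fun i => (hx.2 _).2 ⟨i, rfl⟩
  rw [hx.ncard_neighborSet le_rfl, if_pos (h 0), if_pos (h 1), if_pos (h 2)]

theorem IsPorts.adj {V : Type u} {G : SimpleGraph V} {v : V} {x : Fin 3 → V}
    (hx : IsPorts G v x) (i : Fin 3) : G.Adj v (x i) := (hx.2 _).2 ⟨i, rfl⟩

theorem exists_isPorts {V : Type u} [Finite V] {G : SimpleGraph V} {v : V}
    (h : (G.neighborSet v).ncard = 3) : ∃ x, IsPorts G v x := by
  have e : Nonempty (Fin 3 ≃ G.neighborSet v) := by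
    have : Nat.card (G.neighborSet v) = 3 := h
    exact ⟨(Finite.equivFinOfCardEq this).symm⟩
  obtain ⟨e⟩ := e
  refine ⟨fun i => e i, fun i j hij => e.injective (Subtype.ext hij), fun u => ⟨fun hu => ?_, ?_⟩⟩
  · exact ⟨e.symm ⟨u, hu⟩, by simp⟩
  · rintro ⟨i, rfl⟩
    exact (e i).2

theorem IsTriple.freq_le_two {V : Type u} {G : SimpleGraph V} {R : Set V}
    {M : Fin 3 → SimpleGraph V} (hM : IsTriple G R M) (x y : V) : freq M x y ≤ 2 := by
  classical
  have h := hM.inter x y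
  rw [Fin.forall_fin_succ, Fin.forall_fin_two] at h
  rw [freq_eq]
  simp only [Fin.isValue, Fin.succ_zero_eq_one, Fin.succ_one_eq_two] at h
  split_ifs <;> simp_all

/-- The frequencies at a vertex of degree one sum up to three. -/
theorem IsTriple.freq_sum {V : Type u} {G : SimpleGraph V} {R : Set V}
    {M : Fin 3 → SimpleGraph V} (hM : IsTriple G R M) {v : V} (hv : v ∉ R) {x : Fin 3 → V}
    (hx : IsPorts G v x) : freq M v (x 0) + freq M v (x 1) + freq M v (x 2) = 3 := by
  classical
  have h := fun s => hx.ncard_neighborSet (hM.join s).le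
  have h0 := h 0
  have h1 := h 1
  have h2 := h 2
  rw [(hM.join _).one v hv] at h0 h1 h2
  simp only [freq_eq]
  omega

/-- A join that misses an edge at `v` has degree one there. -/
theorem IsTriple.of_not_adj {V : Type u} {G : SimpleGraph V} {v : V}
    {M : Fin 3 → SimpleGraph V} (hM : IsTriple G {v} M) {x : Fin 3 → V}
    (hx : IsPorts G v x) (h : ∀ s, ∃ i, ¬ (M s).Adj v (x i)) : IsTriple G ∅ M := by
  classical
  refine ⟨fun s => ⟨(hM.join s).le, (hM.join s).odd, fun p _ => ?_⟩, hM.inter⟩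
  by_cases hp : p = v
  · subst hp
    have h1 := (hM.join s).odd p
    rw [hx.ncard_neighborSet (hM.join s).le] at h1 ⊢
    obtain ⟨i, hi⟩ := h s
    revert h1
    fin_cases i <;> simp only [Fin.zero_eta, Fin.mk_one, Fin.reduceFinMk] at hi <;>
      simp only [hi, if_false] <;> split_ifs <;> decide
  · exact (hM.join s).one p hp

theorem even_ncard_odd {V : Type u} [Finite V] (M : SimpleGraph V) :
    Even {p | Odd (M.neighborSet p).ncard}.ncard := by
  classical
  have := Fintype.ofFinite V
  have h := M.even_card_odd_degree_vertices
  rw [Set.ncard_eq_toFinset_card', Set.toFinset_ofPred]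
  convert h using 5 with p
  rw [Set.ncard_eq_toFinset_card', ← M.card_neighborFinset_eq_degree]
  rfl

/-- A graph on the vertex set of a cubic graph cannot have precisely one vertex of even degree. -/
theorem IsCubic₂.not_unique_even {V : Type u} [Finite V] {G : SimpleGraph V} (hG : IsCubic₂ G)
    (M : SimpleGraph V) {v : V} (hv : Even (M.neighborSet v).ncard)
    (h : ∀ p ≠ v, Odd (M.neighborSet p).ncard) : False := by
  have h1 := even_ncard_odd G
  have h2 := even_ncard_odd M
  have e1 : {p | Odd (G.neighborSet p).ncard} = Set.univ := by
    ext p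
    obtain ⟨x, hx⟩ := hG.ports p
    simp [hx.ncard, show Odd 3 by decide]
  have e2 : {p | Odd (M.neighborSet p).ncard} = Set.univ \ {v} := by
    ext p
    by_cases hp : p = v
    · subst hp
      simpa using hv
    · simpa [hp] using h p hp
  rw [e2, Set.ncard_sdiff_singleton_of_mem (Set.mem_univ v)] at h2
  rw [e1] at h1
  have : 0 < (Set.univ : Set V).ncard := (Set.ncard_pos).2 ⟨v, trivial⟩
  -- The number of vertices and its predecessor would both be even.
  grind

/-! ### Translation to and from the definitions of the statement -/

/-- Labels are constant on connected components, and conversely the indicator of reachability from a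
vertex is a test labelling. -/
theorem isBridgelessCubic_iff {V : Type u} [Finite V] {G : SimpleGraph V} [G.LocallyFinite] :
    IsBridgelessCubic G ↔ IsCubic₂ G := by
  have hdeg : ∀ v, (G.neighborSet v).ncard = G.degree v := fun v => by
    rw [Set.ncard_eq_toFinset_card', ← G.card_neighborFinset_eq_degree]
    rfl
  have hreach : ∀ {H : SimpleGraph V} (f : V → Bool) (_ : ∀ x y, H.Adj x y → f x = f y) {x y : V},
      H.Reachable x y → f x = f y := by
    rintro H f hf x y ⟨p⟩
    induction p with
    | nil => rfl
    | cons h _ ih => exact (hf _ _ h).trans ih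
  constructor
  · intro h
    refine ⟨h.connected.nonempty, fun e f hf x y => ?_, fun v => ?_⟩
    · refine hreach f (fun p q hpq => ?_) (h.connected.preconnected x y)
      by_cases he : s(p, q) = e
      · have := h.bridgeless s(p, q) hpq
        rw [isBridge_iff, not_not] at this
        refine hreach f (fun a b hab => ?_) this
        rw [deleteEdges_adj] at hab
        exact hf a b hab.1 (fun h' => hab.2 (by simp [he, h']))
      · exact hf p q hpq he
    · exact exists_isPorts (by rw [hdeg, h.cubic v])
  · intro h
    classical
    have := h.nonempty
    refine ⟨⟨fun x y => ?_⟩, fun v => ?_, fun e => ?_⟩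
    -- A loop is never an edge of the graph, so this choice exempts nothing.
    · have := h.conn s(x, x) (fun z => decide (G.Reachable x z)) (fun a b hab _ => ?_) x y
      · simpa using this
      · simp only [decide_eq_decide]
        exact ⟨fun h => h.trans hab.reachable, fun h => h.trans hab.symm.reachable⟩
    · obtain ⟨x, hx⟩ := h.ports v
      rw [← hdeg, hx.ncard]
    · induction e with | h u v => ?_
      intro _
      rw [isBridge_iff, not_not]
      have := h.conn s(u, v) (fun z => decide ((G.deleteEdges {s(u, v)}).Reachable u z))
        (fun a b hab he => ?_) u v
      · simpa using this
      · simp only [decide_eq_decide]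
        have hab' : (G.deleteEdges {s(u, v)}).Adj a b := by
          rw [deleteEdges_adj]
          exact ⟨hab, by simpa using he⟩
        exact ⟨fun h => h.trans hab'.reachable, fun h => h.trans hab'.symm.reachable⟩

theorem FanRaspaudConjecture.exists_isTriple (h : FanRaspaudConjecture.{u}) {V : Type u} [Finite V]
    {G : SimpleGraph V} (hG : IsCubic₂ G) : ∃ M, IsTriple G ∅ M := by
  classical
  have := Fintype.ofFinite V
  obtain ⟨M, hM, hM'⟩ := h V G (isBridgelessCubic_iff.2 hG)
  have key : ∀ s v, ((M s).spanningCoe.neighborSet v).ncard = 1 := fun s v => by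
    obtain ⟨w, hw, hw'⟩ := Subgraph.isPerfectMatching_iff.1 (hM s) v
    rw [Set.ncard_eq_one]
    exact ⟨w, Set.eq_singleton_iff_unique_mem.2 ⟨hw, hw'⟩⟩
  refine ⟨fun s => (M s).spanningCoe, fun s => ⟨(M s).spanningCoe_le, fun v => ?_,
    fun v _ => key s v⟩, fun x y hxy => ?_⟩
  · rw [key s v]
    exact odd_one
  · have : s(x, y) ∈ (∅ : Set (Sym2 V)) := hM' ▸ ⟨⟨hxy 0, hxy 1⟩, hxy 2⟩
    exact this

theorem IsTriple.exists_isFRTriple {V : Type u} {G : SimpleGraph V} {M : Fin 3 → SimpleGraph V}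
    (hM : IsTriple G ∅ M) :
    ∃ N : Fin 3 → G.Subgraph, IsFRTriple N ∧ ∀ x y, frequency N s(x, y) = freq M x y := by
  refine ⟨fun s => toSubgraph (M s) (hM.join s).le, ⟨fun s => ?_, ?_⟩, fun x y => rfl⟩
  · rw [Subgraph.isPerfectMatching_iff]
    intro v
    obtain ⟨w, hw⟩ := Set.ncard_eq_one.1 ((hM.join s).one v (by simp))
    obtain ⟨h1, h2⟩ := Set.eq_singleton_iff_unique_mem.1 hw
    exact ⟨w, h1, h2⟩
  · ext e
    induction e with | h x y => ?_
    refine ⟨fun h => (hM.inter x y ?_).elim, fun h => h.elim⟩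
    rw [Fin.forall_fin_succ, Fin.forall_fin_two]
    exact ⟨h.1.1, h.1.2, h.2⟩

theorem IsJoin.mono {V : Type u} {G M : SimpleGraph V} {R S : Set V} (h : IsJoin G R M)
    (hRS : R ⊆ S) : IsJoin G S M :=
  ⟨h.le, h.odd, fun v hv => h.one v fun hv' => hv (hRS hv')⟩

theorem IsTriple.mono {V : Type u} {G : SimpleGraph V} {R S : Set V} {M : Fin 3 → SimpleGraph V}
    (h : IsTriple G R M) (hRS : R ⊆ S) : IsTriple G S M :=
  ⟨fun s => (h.join s).mono hRS, h.inter⟩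

/-! ### Contractions -/

/-- `π` contracts a set of vertices of `K` to the vertex `v`, with result `G`. -/
structure Contraction {U V : Type u} (K : SimpleGraph U) (G : SimpleGraph V) (v : V) (π : U → V) :
    Prop where
  inj : ∀ a b, π a = π b → π a ≠ v → a = b
  adj : ∀ a b, K.Adj a b → π a ≠ π b → G.Adj (π a) (π b)
  lift : ∀ p q, G.Adj p q → ∃ a b, K.Adj a b ∧ π a = p ∧ π b = q
  uniq : ∀ a b a' b', K.Adj a b → K.Adj a' b' → π a = π a' → π b = π b' → π a ≠ π b →
    a = a' ∧ b = b'

/-- The image of a graph under a map of vertices. -/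
def contract {U V : Type u} (π : U → V) (M : SimpleGraph U) : SimpleGraph V where
  Adj p q := p ≠ q ∧ ∃ a b, M.Adj a b ∧ π a = p ∧ π b = q
  symm := ⟨fun _ _ ⟨h, a, b, hab, ha, hb⟩ => ⟨h.symm, b, a, hab.symm, hb, ha⟩⟩
  loopless := ⟨fun _ h => h.1 rfl⟩

namespace Contraction

variable {U V : Type u} {K : SimpleGraph U} {G : SimpleGraph V} {v : V} {π : U → V}

theorem contract_adj (h : Contraction K G v π) {M : SimpleGraph U} (hM : M ≤ K) {a b : U}
    (hab : K.Adj a b) (hne : π a ≠ π b) : (contract π M).Adj (π a) (π b) ↔ M.Adj a b := by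
  constructor
  · rintro ⟨-, a', b', hab', ha, hb⟩
    obtain ⟨rfl, rfl⟩ := h.uniq a b a' b' hab (hM hab') ha.symm hb.symm hne
    exact hab'
  · exact fun h' => ⟨hne, a, b, h', rfl, rfl⟩

theorem freq_contract (h : Contraction K G v π) {M : Fin 3 → SimpleGraph U} (hM : ∀ s, M s ≤ K)
    {a b : U} (hab : K.Adj a b) (hne : π a ≠ π b) :
    freq (fun s => contract π (M s)) (π a) (π b) = freq M a b := by
  simp only [freq, h.contract_adj (hM _) hab hne]

/-- Off `v` the fibres of `π` are single vertices and no edge at them is collapsed or identified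
with another. -/
theorem ncard_neighborSet (h : Contraction K G v π) {M : SimpleGraph U} (hM : M ≤ K) {a : U}
    (ha : π a ≠ v) : ((contract π M).neighborSet (π a)).ncard = (M.neighborSet a).ncard := by
  have hne : ∀ b, K.Adj a b → π a ≠ π b := fun b hab hπ => hab.ne (h.inj a b hπ ha)
  have : (contract π M).neighborSet (π a) = π '' M.neighborSet a := by
    ext q
    constructor
    · rintro ⟨-, a', b, hab, ha', rfl⟩
      obtain rfl := h.inj a a' ha'.symm ha
      exact ⟨b, hab, rfl⟩
    · rintro ⟨b, hab, rfl⟩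
      exact ⟨hne b (hM hab), a, b, hab, rfl, rfl⟩
  rw [this, Set.InjOn.ncard_image]
  intro b hb b' hb' hbb
  exact (h.uniq a b a b' (hM hb) (hM hb') rfl hbb (hne b (hM hb))).2

/-- Only the degree at `v` is in doubt, and `v` cannot be the unique vertex of even degree. That
degree may be three, which is why `v` enters the exceptional set. -/
theorem isJoin [Finite V] (h : Contraction K G v π) (hG : IsCubic₂ G) {R : Set U}
    {M : SimpleGraph U} (hM : IsJoin K R M) : IsJoin G (insert v (π '' R)) (contract π M) := by
  have surj : ∀ p, ∃ a, π a = p := fun p => by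
    obtain ⟨x, hx⟩ := hG.ports p
    obtain ⟨a, -, -, ha, -⟩ := h.lift p (x 0) (hx.adj 0)
    exact ⟨a, ha⟩
  have hodd : ∀ p ≠ v, Odd ((contract π M).neighborSet p).ncard := fun p hp => by
    obtain ⟨a, rfl⟩ := surj p
    rw [h.ncard_neighborSet hM.le hp]
    exact hM.odd a
  refine ⟨?_, fun p => ?_, fun p hp => ?_⟩
  · rintro p q ⟨hpq, a, b, hab, rfl, rfl⟩
    exact h.adj a b (hM.le hab) hpq
  · by_cases hp : p = v
    · subst hp
      by_contra hev
      exact hG.not_unique_even _ (Nat.not_odd_iff_even.1 hev) hodd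
    · exact hodd p hp
  · obtain ⟨a, rfl⟩ := surj p
    rw [Set.mem_insert_iff, not_or] at hp
    rw [h.ncard_neighborSet hM.le hp.1]
    exact hM.one a fun ha => hp.2 ⟨a, ha, rfl⟩

theorem isTriple [Finite V] (h : Contraction K G v π) (hG : IsCubic₂ G) {R : Set U}
    {M : Fin 3 → SimpleGraph U} (hM : IsTriple K R M) :
    IsTriple G (insert v (π '' R)) fun s => contract π (M s) := by
  refine ⟨fun s => h.isJoin hG (hM.join s), fun p q hpq => ?_⟩
  obtain ⟨hne, a, b, hab, rfl, rfl⟩ := hpq 0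
  exact hM.inter a b fun s =>
    (h.contract_adj (hM.join s).le ((hM.join 0).le hab) hne).1 (hpq s)

end Contraction

/-! ### Three-sums -/

section ThreeSum

variable {V W : Type u}

/-- If a labelling is constant along all edges avoiding `v` then so it is on the vertices other
than `v`. -/
theorem TwoEdgeConnected.const_off {G : SimpleGraph V} (hG : TwoEdgeConnected G) {v : V}
    {x : Fin 3 → V} (hx : IsPorts G v x) (f : V → Bool)
    (hf : ∀ p q, p ≠ v → q ≠ v → G.Adj p q → f p = f q) :
    ∀ p q, p ≠ v → q ≠ v → f p = f q := by
  classical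
  -- Among three labels two agree. With this majority label at `v`, only the edge to `x j` can be
  -- violated, and one violation is allowed.
  obtain ⟨c, j, hc⟩ : ∃ (c : Bool) (j : Fin 3), ∀ i ≠ j, f (x i) = c := by
    rcases h0 : f (x 0) <;> rcases h1 : f (x 1) <;> rcases h2 : f (x 2)
    · exact ⟨false, 0, fun i _ => by fin_cases i <;> assumption⟩
    · exact ⟨false, 2, fun i _ => by fin_cases i <;> first | assumption | contradiction⟩
    · exact ⟨false, 1, fun i _ => by fin_cases i <;> first | assumption | contradiction⟩
    · exact ⟨true, 0, fun i _ => by fin_cases i <;> first | assumption | contradiction⟩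
    · exact ⟨false, 0, fun i _ => by fin_cases i <;> first | assumption | contradiction⟩
    · exact ⟨true, 1, fun i _ => by fin_cases i <;> first | assumption | contradiction⟩
    · exact ⟨true, 2, fun i _ => by fin_cases i <;> first | assumption | contradiction⟩
    · exact ⟨true, 0, fun i _ => by fin_cases i <;> assumption⟩
  have key : ∀ q, G.Adj v q → s(v, q) ≠ s(v, x j) → f q = c := fun q hq hne => by
    obtain ⟨i, rfl⟩ := (hx.2 q).1 hq
    exact hc i fun hij => hne (by rw [hij])
  have := hG s(v, x j) (Function.update f v c) fun p q hpq hne => ?_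
  · intro p q hp hq
    simpa [hp, hq] using this p q
  · by_cases hp : p = v
    · subst hp
      simp [hpq.ne', key q hpq hne]
    · by_cases hq : q = v
      · subst hq
        simp [hp, key p hpq.symm (by rwa [Sym2.eq_swap])]
      · simpa [hp, hq] using hf p q hp hq hpq

/-- Labellings of the two sides of a three-sum that agree along the cut and change along at most
one edge on the left. -/
theorem TwoEdgeConnected.const_of_left {G : SimpleGraph V} {H : SimpleGraph W}
    (hG : TwoEdgeConnected G) (hH : TwoEdgeConnected H) {v : V} {w : W} {x : Fin 3 → V}
    {y : Fin 3 → W} (hx : IsPorts G v x) (hy : IsPorts H w y) (f : V → Bool) (g : W → Bool)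
    (e : Sym2 V) (hf : ∀ p q, p ≠ v → q ≠ v → G.Adj p q → s(p, q) ≠ e → f p = f q)
    (hg : ∀ p q, p ≠ w → q ≠ w → H.Adj p q → g p = g q) (hfg : ∀ i, f (x i) = g (y i)) :
    ∀ p q, p ≠ v → q ≠ w → f p = g q := by
  classical
  have hy0 : ∀ i, y i ≠ w := fun i => (hy.adj i).ne'
  have hx0 : ∀ i, x i ≠ v := fun i => (hx.adj i).ne'
  have hgc := hH.const_off hy g hg
  have key : ∀ q, G.Adj v q → f q = g (y 0) := fun q hq => by
    obtain ⟨i, rfl⟩ := (hx.2 q).1 hq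
    rw [hfg, hgc _ _ (hy0 i) (hy0 0)]
  -- The right side carries a single label; with it at `v`, which stands for that side, only `e` can
  -- be violated.
  have := hG e (Function.update f v (g (y 0))) fun p q hpq hne => ?_
  · intro p q hp hq
    have := this p (x 0)
    rw [Function.update_of_ne hp, Function.update_of_ne (hx0 0)] at this
    rw [this, hfg, hgc _ _ (hy0 0) hq]
  · by_cases hp : p = v
    · subst hp
      simp [hpq.ne', key q hpq]
    · by_cases hq : q = v
      · subst hq
        simp [hp, key p hpq.symm]
      · simpa [hp, hq] using hf p q hp hq hpq hne

/-- Remove `v` and `w` and join their neighbours, as listed by `x` and `y`, in pairs. -/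
def threeSum (G : SimpleGraph V) (H : SimpleGraph W) (v : V) (w : W) (x : Fin 3 → V)
    (y : Fin 3 → W) : SimpleGraph ({p // p ≠ v} ⊕ {q // q ≠ w}) where
  Adj
    | .inl p, .inl p' => G.Adj p p'
    | .inr q, .inr q' => H.Adj q q'
    | .inl p, .inr q => ∃ i, x i = p ∧ y i = q
    | .inr q, .inl p => ∃ i, x i = p ∧ y i = q
  symm := ⟨by
    rintro (p | q) (p' | q') h
    · exact h.symm
    · exact h
    · exact h
    · exact h.symm⟩
  loopless := ⟨by
    rintro (p | q) h
    · exact G.irrefl h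
    · exact H.irrefl h⟩

/-- A neighbour `x j` of `v` trades `v` for `y j`; every other vertex keeps its neighbours. -/
theorem threeSum_isPorts_inl [DecidableEq V] (G : SimpleGraph V) (H : SimpleGraph W) (v : V) (w : W)
    {x : Fin 3 → V} {y : Fin 3 → W} (hx : IsPorts G v x) (hy : IsPorts H w y) (p : {p // p ≠ v})
    (hp : ∃ z, IsPorts G p z) : ∃ z, IsPorts (threeSum G H v w x y) (.inl p) z := by
  obtain ⟨z, hz⟩ := hp
  by_cases hpx : ∃ j, x j = p
  · obtain ⟨j, hj⟩ := hpx
    refine ⟨fun i => if h : z i = v then .inr ⟨y j, (hy.adj j).ne'⟩ else .inl ⟨z i, h⟩,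
      fun i i' hii => hz.1 ?_, ?_⟩
    · by_cases h : z i = v <;> by_cases h' : z i' = v <;> simp_all
    · rintro (q | q)
      · refine (hz.2 q).trans (exists_congr fun i => ?_)
        by_cases h : z i = v
        · simp [h, q.2.symm]
        · simp [h, Subtype.ext_iff]
      · constructor
        · rintro ⟨i, hi, hiq⟩
          obtain rfl : i = j := hx.1 (hi.trans hj.symm)
          obtain ⟨k, hk⟩ := (hz.2 v).1 (hj ▸ (hx.adj i).symm)
          exact ⟨k, by simp [hk, hiq]⟩
        · rintro ⟨i, hi⟩
          by_cases h : z i = v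
          · simp only [dif_pos h, Sum.inr.injEq] at hi
            exact ⟨j, hj, by simp [← hi]⟩
          · simp [h] at hi
  · have hzv : ∀ i, z i ≠ v := fun i h => hpx ((hx.2 p).1 (h ▸ (hz.adj i).symm))
    refine ⟨fun i => .inl ⟨z i, hzv i⟩, fun i i' hii => hz.1 (by simpa using hii), ?_⟩
    rintro (q | q)
    · refine (hz.2 q).trans (exists_congr fun i => ?_)
      simp [Subtype.ext_iff]
    · constructor
      · rintro ⟨i, hi, -⟩
        exact (hpx ⟨i, hi⟩).elim
      · rintro ⟨i, hi⟩
        simp at hi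

theorem threeSum_swap (G : SimpleGraph V) (H : SimpleGraph W) (v : V) (w : W)
    (x : Fin 3 → V) (y : Fin 3 → W) (a b : {p // p ≠ v} ⊕ {q // q ≠ w}) :
    (threeSum H G w v y x).Adj a.swap b.swap ↔ (threeSum G H v w x y).Adj a b := by
  rcases a with a | a <;> rcases b with b | b <;> simp [threeSum, and_comm]

/-- Collapsing the `H` side turns the cut edges into the edges at `v`; these lift uniquely because
`x` is injective. -/
theorem threeSum_contraction (G : SimpleGraph V) (H : SimpleGraph W) (v : V) (w : W)
    {x : Fin 3 → V} {y : Fin 3 → W} (hx : IsPorts G v x) (hy : IsPorts H w y) :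
    Contraction (threeSum G H v w x y) G v (Sum.elim Subtype.val fun _ => v) := by
  have hy0 : ∀ i, y i ≠ w := fun i => (hy.adj i).ne'
  have hx0 : ∀ i, x i ≠ v := fun i => (hx.adj i).ne'
  refine ⟨?_, ?_, ?_, ?_⟩
  · rintro (a | a) (b | b) h hv
    · rw [Subtype.ext h]
    · exact (hv h).elim
    · exact (hv rfl).elim
    · exact (hv rfl).elim
  · rintro (a | a) (b | b) h hv
    · exact h
    · obtain ⟨i, hi, -⟩ := h
      exact (hi ▸ (hx.adj i).symm : G.Adj a v)
    · obtain ⟨i, hi, -⟩ := h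
      exact (hi ▸ hx.adj i : G.Adj v b)
    · exact (hv rfl).elim
  · intro p q hpq
    by_cases hp : p = v
    · subst hp
      obtain ⟨i, rfl⟩ := (hx.2 q).1 hpq
      exact ⟨.inr ⟨y i, hy0 i⟩, .inl ⟨x i, hx0 i⟩, ⟨i, rfl, rfl⟩, rfl, rfl⟩
    · by_cases hq : q = v
      · subst hq
        obtain ⟨i, rfl⟩ := (hx.2 p).1 hpq.symm
        exact ⟨.inl ⟨x i, hx0 i⟩, .inr ⟨y i, hy0 i⟩, ⟨i, rfl, rfl⟩, rfl, rfl⟩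
      · exact ⟨.inl ⟨p, hp⟩, .inl ⟨q, hq⟩, hpq, rfl, rfl⟩
  · have cross : ∀ (p p' : {p // p ≠ v}) (q q' : {q // q ≠ w}), (∃ i, x i = p ∧ y i = q) →
        (∃ i, x i = p' ∧ y i = q') → p.1 = p'.1 → p = p' ∧ q = q' := by
      rintro p p' q q' ⟨i, hi, hi'⟩ ⟨j, hj, hj'⟩ h
      obtain rfl : i = j := hx.1 (by rw [hi, hj, h])
      exact ⟨Subtype.ext h, Subtype.ext (hi'.symm.trans hj')⟩
    rintro (a | a) (b | b) (a' | a') (b' | b') h h' ha hb hne <;>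
      simp only [Sum.elim_inl, Sum.elim_inr] at ha hb hne
    · exact ⟨by rw [Subtype.ext ha], by rw [Subtype.ext hb]⟩
    · exact (b.2 hb).elim
    · exact (a.2 ha).elim
    · exact (a.2 ha).elim
    · exact (b'.2 hb.symm).elim
    · obtain ⟨rfl, rfl⟩ := cross a a' b b' h h' ha
      exact ⟨rfl, rfl⟩
    · exact (a.2 ha).elim
    · exact (a.2 ha).elim
    · exact (a'.2 ha.symm).elim
    · exact (a'.2 ha.symm).elim
    · obtain ⟨rfl, rfl⟩ := cross b b' a a' h h' hb
      exact ⟨rfl, rfl⟩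
    · exact (b.2 hb).elim
    all_goals exact (hne rfl).elim

theorem Contraction.comp_swap {A B : Type u} {K : SimpleGraph (A ⊕ B)} {L : SimpleGraph (B ⊕ A)}
    {G : SimpleGraph V} {v : V} {π : B ⊕ A → V} (h : Contraction L G v π)
    (hKL : ∀ a b, L.Adj a.swap b.swap ↔ K.Adj a b) :
    Contraction K G v (fun a => π a.swap) := by
  have hs : ∀ a b : A ⊕ B, a.swap = b.swap → a = b := fun a b hab => by
    rw [← Sum.swap_swap a, hab, Sum.swap_swap]
  refine ⟨fun a b hab hv => hs _ _ (h.inj _ _ hab hv), fun a b hab => h.adj _ _ ((hKL a b).2 hab),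
    fun p q hpq => ?_, fun a b a' b' hab hab' ha hb hne => ?_⟩
  · obtain ⟨a, b, hab, ha, hb⟩ := h.lift p q hpq
    exact ⟨a.swap, b.swap, by rw [← hKL, Sum.swap_swap, Sum.swap_swap]; exact hab,
      by rwa [Sum.swap_swap], by rwa [Sum.swap_swap]⟩
  · have := h.uniq _ _ _ _ ((hKL a b).2 hab) ((hKL a' b').2 hab') ha hb hne
    exact ⟨hs _ _ this.1, hs _ _ this.2⟩

/-- If the exempted edge lies on one side, the other side behaves like a single vertex. If it is a
cut edge, both sides are constant and another cut edge links them. -/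
theorem threeSum_twoEdgeConnected {G : SimpleGraph V} {H : SimpleGraph W}
    (hG : TwoEdgeConnected G) (hH : TwoEdgeConnected H) {v : V} {w : W} {x : Fin 3 → V}
    {y : Fin 3 → W} (hx : IsPorts G v x) (hy : IsPorts H w y) :
    TwoEdgeConnected (threeSum G H v w x y) := by
  classical
  have hy0 : ∀ i, y i ≠ w := fun i => (hy.adj i).ne'
  have hx0 : ∀ i, x i ≠ v := fun i => (hx.adj i).ne'
  intro e f hf
  -- The values at the removed vertices are placeholders that play no role.
  let f₁ : V → Bool := fun p => if h : p = v then false else f (.inl ⟨p, h⟩)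
  let f₂ : W → Bool := fun q => if h : q = w then false else f (.inr ⟨q, h⟩)
  have e₁ : ∀ p (h : p ≠ v), f₁ p = f (.inl ⟨p, h⟩) := fun p h => dif_neg h
  have e₂ : ∀ q (h : q ≠ w), f₂ q = f (.inr ⟨q, h⟩) := fun q h => dif_neg h
  suffices h : ∀ p q, p ≠ v → q ≠ w → f₁ p = f₂ q by
    have h' : ∀ (p : {p // p ≠ v}) (q : {q // q ≠ w}), f (.inl p) = f (.inr q) := fun p q => by
      rw [← e₁ p p.2, ← e₂ q q.2, h p q p.2 q.2]
    rintro (a | a) (b | b)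
    · rw [h' a ⟨y 0, hy0 0⟩, h' b]
    · exact h' a b
    · exact (h' b a).symm
    · rw [← h' ⟨x 0, hx0 0⟩ a, h']
  have hl : ∀ p q (hp : p ≠ v) (hq : q ≠ v), G.Adj p q →
      s(Sum.inl ⟨p, hp⟩, Sum.inl ⟨q, hq⟩) ≠ e → f₁ p = f₁ q := fun p q hp hq hpq hne => by
    rw [e₁ p hp, e₁ q hq]
    exact hf _ _ hpq hne
  have hr : ∀ p q (hp : p ≠ w) (hq : q ≠ w), H.Adj p q →
      s(Sum.inr ⟨p, hp⟩, Sum.inr ⟨q, hq⟩) ≠ e → f₂ p = f₂ q := fun p q hp hq hpq hne => by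
    rw [e₂ p hp, e₂ q hq]
    exact hf _ _ hpq hne
  have hc : ∀ i, s(Sum.inl ⟨x i, hx0 i⟩, Sum.inr ⟨y i, hy0 i⟩) ≠ e → f₁ (x i) = f₂ (y i) :=
      fun i hne => by
    rw [e₁ _ (hx0 i), e₂ _ (hy0 i)]
    exact hf _ _ ⟨i, rfl, rfl⟩ hne
  have cross : ∀ (a : {p // p ≠ v}) (b : {q // q ≠ w}), e = s(.inl a, .inr b) →
      ∀ p q, p ≠ v → q ≠ w → f₁ p = f₂ q := by
    rintro a b rfl p q hp hq
    have hl' := hG.const_off hx f₁ fun p q hp hq hpq => hl p q hp hq hpq (by simp)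
    have hr' := hH.const_off hy f₂ fun p q hp hq hpq => hr p q hp hq hpq (by simp)
    -- This picks a cut edge that is not exempted.
    obtain ⟨i, hi⟩ : ∃ i, x i ≠ a := by
      by_contra! h
      exact absurd (hx.1 ((h 0).trans (h 1).symm)) (by decide)
    have hi' := hc i (by simp [Subtype.ext_iff, hi])
    rw [hl' p (x i) hp (hx0 i), hi', hr' _ _ (hy0 i) hq]
  induction e with | h a b => ?_
  rcases a with a | a <;> rcases b with b | b
  · refine hG.const_of_left hH hx hy f₁ f₂ s(a.1, b.1) (fun p q hp hq hpq hne => ?_)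
      (fun p q hp hq hpq => hr p q hp hq hpq (by simp)) (fun i => hc i (by simp))
    exact hl p q hp hq hpq (by simpa [Subtype.ext_iff] using hne)
  · exact cross a b rfl
  · exact cross b a Sym2.eq_swap
  · intro p q hp hq
    refine (hH.const_of_left hG hy hx f₂ f₁ s(a.1, b.1) (fun p q hp hq hpq hne => ?_)
      (fun p q hp hq hpq => hl p q hp hq hpq (by simp)) (fun i => (hc i (by simp)).symm) q p hq
      hp).symm
    exact hr p q hp hq hpq (by simpa [Subtype.ext_iff] using hne)

/-- Two cubic graphs are the two contractions of a three-edge cut of a third one. -/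
theorem exists_threeSum [Finite V] [Finite W] {G : SimpleGraph V} {H : SimpleGraph W}
    (hG : IsCubic₂ G) (hH : IsCubic₂ H) {v : V} {w : W} {x : Fin 3 → V} {y : Fin 3 → W}
    (hx : IsPorts G v x) (hy : IsPorts H w y) :
    ∃ (U : Type u) (_ : Finite U) (K : SimpleGraph U) (π : U → V) (ρ : U → W),
      IsCubic₂ K ∧ Contraction K G v π ∧ Contraction K H w ρ ∧ (∀ a, π a ≠ v → ρ a = w) ∧
      ∀ i, ∃ a b, K.Adj a b ∧ π a = x i ∧ π b = v ∧ ρ a = w ∧ ρ b = y i := by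
  classical
  have hy0 : ∀ i, y i ≠ w := fun i => (hy.adj i).ne'
  have hx0 : ∀ i, x i ≠ v := fun i => (hx.adj i).ne'
  refine ⟨{p // p ≠ v} ⊕ {q // q ≠ w}, inferInstance, threeSum G H v w x y,
    Sum.elim Subtype.val fun _ => v, fun a => Sum.elim Subtype.val (fun _ => w) a.swap,
    ⟨⟨.inl ⟨x 0, hx0 0⟩⟩, threeSum_twoEdgeConnected hG.conn hH.conn hx hy, ?_⟩,
    threeSum_contraction G H v w hx hy,
    (threeSum_contraction H G w v hy hx).comp_swap (threeSum_swap G H v w x y), ?_,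
    fun i => ⟨.inl ⟨x i, hx0 i⟩, .inr ⟨y i, hy0 i⟩, ⟨i, rfl, rfl⟩, rfl, rfl, rfl, rfl⟩⟩
  · rintro (p | q)
    · exact threeSum_isPorts_inl G H v w hx hy p (hG.ports p)
    · obtain ⟨z, hz⟩ := threeSum_isPorts_inl H G w v hy hx q (hH.ports q)
      refine ⟨fun i => (z i).swap, fun i j hij => hz.1 ?_, fun u => ?_⟩
      · simpa using congrArg Sum.swap hij
      · rw [← threeSum_swap G H v w x y]
        refine (hz.2 u.swap).trans (exists_congr fun i => ?_)
        exact ⟨fun h => by simp [h], fun h => by simp [← h]⟩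
  · rintro (p | q) h
    · rfl
    · exact (h rfl).elim

end ThreeSum

theorem IsJoin.existsUnique {V : Type u} {G M : SimpleGraph V} (h : IsJoin G ∅ M) (v : V) :
    ∃! w, M.Adj v w := by
  obtain ⟨w, hw⟩ := Set.ncard_eq_one.1 (h.one v (by simp))
  obtain ⟨h1, h2⟩ := Set.eq_singleton_iff_unique_mem.1 hw
  exact ⟨w, h1, h2⟩

theorem ncard_neighborSet_eq_one {V : Type u} {M : SimpleGraph V} {v : V} (h : ∃! w, M.Adj v w) :
    (M.neighborSet v).ncard = 1 := by
  obtain ⟨w, hw, hw'⟩ := h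
  exact Set.ncard_eq_one.2 ⟨w, Set.eq_singleton_iff_unique_mem.2 ⟨hw, hw'⟩⟩

theorem isJoin_of_existsUnique {V : Type u} {G M : SimpleGraph V} (hle : M ≤ G)
    (h : ∀ v, ∃! w, M.Adj v w) : IsJoin G ∅ M :=
  ⟨hle, fun v => ncard_neighborSet_eq_one (h v) ▸ odd_one, fun v _ => ncard_neighborSet_eq_one (h v)⟩

/-! ### Two-sums -/

section TwoSum

variable {U V W : Type u}

/-- `K` is obtained from `G`, embedded by `ι`, by replacing the edge `uv` by a part of a graph that
is attached to `u` and `v` by edges to `p` and `q`. -/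
structure Splice (K : SimpleGraph U) (G : SimpleGraph V) (u v : V) (ι : V → U) (p q : U) :
    Prop where
  uv : G.Adj u v
  inj : Function.Injective ι
  adj : ∀ a b, K.Adj (ι a) (ι b) ↔ G.Adj a b ∧ s(a, b) ≠ s(u, v)
  out : ∀ a z, z ∉ Set.range ι → (K.Adj (ι a) z ↔ (a = u ∧ z = p) ∨ (a = v ∧ z = q))
  hp : p ∉ Set.range ι
  hq : q ∉ Set.range ι

/-- The graph that `M` induces on `G` when the spliced part is replaced by the edge `uv`. -/
def unsplice (u v : V) (ι : V → U) (p : U) (M : SimpleGraph U) : SimpleGraph V where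
  Adj a b := M.Adj (ι a) (ι b) ∨ (a ≠ b ∧ s(a, b) = s(u, v) ∧ M.Adj (ι u) p)
  symm := ⟨by
    rintro a b (h | ⟨h, h', h''⟩)
    · exact .inl h.symm
    · exact .inr ⟨h.symm, by rwa [Sym2.eq_swap], h''⟩⟩
  loopless := ⟨by
    rintro a (h | h)
    · exact M.irrefl h
    · exact h.1 rfl⟩

namespace Splice

variable {K : SimpleGraph U} {G : SimpleGraph V} {u v : V} {ι : V → U} {p q : U}

theorem not_adj (h : Splice K G u v ι p q) : ¬ K.Adj (ι u) (ι v) := fun h' =>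
  ((h.adj u v).1 h').2 rfl

theorem unsplice_adj (h : Splice K G u v ι p q) {M : SimpleGraph U} (hM : M ≤ K) :
    (unsplice u v ι p M).Adj u v ↔ M.Adj (ι u) p := by
  constructor
  · rintro (h' | h')
    · exact (h.not_adj (hM h')).elim
    · exact h'.2.2
  · exact fun h' => .inr ⟨h.uv.ne, rfl, h'⟩

theorem unsplice_adj_of_ne {M : SimpleGraph U} {a b : V} (hab : s(a, b) ≠ s(u, v)) :
    (unsplice u v ι p M).Adj a b ↔ M.Adj (ι a) (ι b) :=
  ⟨fun h => h.resolve_right fun h' => hab h'.2.1, .inl⟩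

theorem existsUnique_comap (h : Splice K G u v ι p q) {M : SimpleGraph U} (hM : IsJoin K ∅ M)
    {a : V} (ha : ∀ z ∉ Set.range ι, ¬ M.Adj (ι a) z) : ∃! b, (M.comap ι).Adj a b := by
  obtain ⟨c, hc, hc'⟩ := hM.existsUnique (ι a)
  obtain ⟨b, rfl⟩ : c ∈ Set.range ι := by
    by_contra hcon
    exact ha c hcon hc
  exact ⟨b, hc, fun b' hb' => h.inj (hc' _ hb')⟩

theorem not_comap_adj {M : SimpleGraph U} (hM : IsJoin K ∅ M)
    {a : V} {z : U} (hz : z ∉ Set.range ι) (ha : M.Adj (ι a) z) (b : V) :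
    ¬ (M.comap ι).Adj a b := fun hb =>
  hz ⟨b, (hM.existsUnique (ι a)).unique hb ha⟩

/-- A perfect matching contains both or none of the two edges of the cut. -/
theorem adj_iff [Finite V] (h : Splice K G u v ι p q) (hG : IsCubic₂ G) {M : SimpleGraph U}
    (hM : IsJoin K ∅ M) : M.Adj (ι u) p ↔ M.Adj (ι v) q := by
  -- Restricted to the vertices of `G`, the matching has degree one except at ends of used cut
  -- edges, where it has degree zero. A single used cut edge would leave exactly one even degree.
  have hodd : ∀ a, (a = u → ¬ M.Adj (ι u) p) → (a = v → ¬ M.Adj (ι v) q) →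
      Odd ((M.comap ι).neighborSet a).ncard := fun a hu hv => by
    rw [ncard_neighborSet_eq_one (h.existsUnique_comap hM fun z hz haz => ?_)]
    · exact odd_one
    · rcases (h.out a z hz).1 (hM.le haz) with ⟨rfl, rfl⟩ | ⟨rfl, rfl⟩
      · exact hu rfl haz
      · exact hv rfl haz
  have heven : ∀ a z, z ∉ Set.range ι → M.Adj (ι a) z →
      Even ((M.comap ι).neighborSet a).ncard := fun a z hz haz => by
    rw [show (M.comap ι).neighborSet a = ∅ from
      Set.eq_empty_iff_forall_notMem.2 (not_comap_adj hM hz haz)]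
    simp
  constructor
  · intro hu
    by_contra hv
    exact hG.not_unique_even _ (heven u p h.hp hu) fun a ha =>
      hodd a (fun h' => (ha h').elim) fun _ => hv
  · intro hv
    by_contra hu
    exact hG.not_unique_even _ (heven v q h.hq hv) fun a ha =>
      hodd a (fun _ => hu) fun h' => (ha h').elim

/-- If both cut edges are used, `uv` matches the two vertices left uncovered; if none is, the
restriction is already perfect. By `adj_iff` there is no third case, so testing the edge at `u`
alone suffices. -/
theorem isJoin [Finite V] (h : Splice K G u v ι p q) (hG : IsCubic₂ G) {M : SimpleGraph U}
    (hM : IsJoin K ∅ M) : IsJoin G ∅ (unsplice u v ι p M) := by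
  have huv := h.uv.ne
  refine isJoin_of_existsUnique ?_ fun a => ?_
  · rintro a b (hab | ⟨-, hab, -⟩)
    · exact ((h.adj a b).1 (hM.le hab)).1
    · rw [← mem_edgeSet, hab]
      exact h.uv
  · by_cases hcut : M.Adj (ι u) p
    · have hcut' := (h.adj_iff hG hM).1 hcut
      by_cases hu : a = u
      · subst hu
        refine ⟨v, (h.unsplice_adj hM.le).2 hcut, ?_⟩
        rintro b (hb | ⟨-, hb, -⟩)
        · exact (not_comap_adj hM h.hp hcut b hb).elim
        · exact Sym2.congr_right.1 hb
      by_cases hv : a = v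
      · subst hv
        refine ⟨u, ((h.unsplice_adj hM.le).2 hcut).symm, ?_⟩
        rintro b (hb | ⟨-, hb, -⟩)
        · exact (not_comap_adj hM h.hq hcut' b hb).elim
        · exact Sym2.congr_left.1 (Sym2.eq_swap.trans hb)
      obtain ⟨b, hb, hb'⟩ := h.existsUnique_comap hM (a := a) fun z hz haz => by
        rcases (h.out a z hz).1 (hM.le haz) with ⟨h', -⟩ | ⟨h', -⟩
        · exact hu h'
        · exact hv h'
      refine ⟨b, .inl hb, ?_⟩
      rintro c (hc | ⟨-, hc, -⟩)
      · exact hb' c hc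
      · rcases Sym2.eq_iff.1 hc with ⟨h', -⟩ | ⟨h', -⟩
        · exact (hu h').elim
        · exact (hv h').elim
    · have hcut' := fun h' => hcut ((h.adj_iff hG hM).2 h')
      obtain ⟨b, hb, hb'⟩ := h.existsUnique_comap hM (a := a) fun z hz haz => by
        rcases (h.out a z hz).1 (hM.le haz) with ⟨rfl, rfl⟩ | ⟨rfl, rfl⟩
        · exact hcut haz
        · exact hcut' haz
      refine ⟨b, .inl hb, ?_⟩
      rintro c (hc | ⟨-, -, hc⟩)
      · exact hb' c hc
      · exact (hcut hc).elim

theorem isTriple [Finite V] (h : Splice K G u v ι p q) (hG : IsCubic₂ G)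
    {M : Fin 3 → SimpleGraph U} (hM : IsTriple K ∅ M) :
    IsTriple G ∅ fun s => unsplice u v ι p (M s) := by
  refine ⟨fun s => h.isJoin hG (hM.join s), fun a b hab => ?_⟩
  by_cases he : s(a, b) = s(u, v)
  · refine hM.inter (ι u) p fun s => ?_
    rcases hab s with h' | h'
    · exact (((h.adj a b).1 ((hM.join s).le h')).2 he).elim
    · exact h'.2.2
  · exact hM.inter (ι a) (ι b) fun s => (unsplice_adj_of_ne he).1 (hab s)

end Splice

/-- Replace the edges `uv` and `xy` by `ux` and `vy`. -/
def twoSum (G : SimpleGraph V) (H : SimpleGraph W) (u v : V) (x y : W) : SimpleGraph (V ⊕ W) where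
  Adj
    | .inl a, .inl b => G.Adj a b ∧ s(a, b) ≠ s(u, v)
    | .inr a, .inr b => H.Adj a b ∧ s(a, b) ≠ s(x, y)
    | .inl a, .inr b => (a = u ∧ b = x) ∨ (a = v ∧ b = y)
    | .inr b, .inl a => (a = u ∧ b = x) ∨ (a = v ∧ b = y)
  symm := ⟨by
    rintro (a | a) (b | b) h
    · exact ⟨h.1.symm, by rw [Sym2.eq_swap]; exact h.2⟩
    · exact h
    · exact h
    · exact ⟨h.1.symm, by rw [Sym2.eq_swap]; exact h.2⟩⟩
  loopless := ⟨by
    rintro (a | a) h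
    · exact G.irrefl h.1
    · exact H.irrefl h.1⟩

theorem twoSum_swap (G : SimpleGraph V) (H : SimpleGraph W) (u v : V) (x y : W) (a b : V ⊕ W) :
    (twoSum H G x y u v).Adj a.swap b.swap ↔ (twoSum G H u v x y).Adj a b := by
  rcases a with a | a <;> rcases b with b | b <;> simp [twoSum, and_comm]

/-- The vertex `u` trades `v` for `x`, and `v` trades `u` for `y`. -/
theorem twoSum_isPorts_inl (G : SimpleGraph V) (H : SimpleGraph W) {u v : V}
    {x y : W} (huv : G.Adj u v) (a : V) (ha : ∃ z, IsPorts G a z) :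
    ∃ z, IsPorts (twoSum G H u v x y) (.inl a) z := by
  classical
  obtain ⟨z, hz⟩ := ha
  have huv' := huv.ne
  by_cases hu : a = u
  · subst hu
    obtain ⟨j, hj⟩ := (hz.2 v).1 huv
    refine ⟨fun i => if z i = v then .inr x else .inl (z i), fun i i' hii => hz.1 ?_, ?_⟩
    · by_cases h : z i = v <;> by_cases h' : z i' = v <;> simp_all
    · rintro (b | b)
      · constructor
        · rintro ⟨h, hne⟩
          obtain ⟨i, rfl⟩ := (hz.2 b).1 h
          refine ⟨i, ?_⟩
          have : z i ≠ v := fun h => hne (by rw [h])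
          simp [this]
        · rintro ⟨i, hi⟩
          by_cases h : z i = v
          · simp [h] at hi
          · simp only [h, if_false, Sum.inl.injEq] at hi
            subst hi
            exact ⟨hz.adj i, fun h' => h (Sym2.congr_right.1 h')⟩
      · constructor
        · rintro (⟨-, rfl⟩ | ⟨h, -⟩)
          · exact ⟨j, by simp [hj]⟩
          · exact (huv' h).elim
        · rintro ⟨i, hi⟩
          by_cases h : z i = v
          · simp only [h, if_true, Sum.inr.injEq] at hi
            exact .inl ⟨rfl, hi.symm⟩
          · simp [h] at hi
  by_cases hv : a = v
  · subst hv
    obtain ⟨j, hj⟩ := (hz.2 u).1 huv.symm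
    refine ⟨fun i => if z i = u then .inr y else .inl (z i), fun i i' hii => hz.1 ?_, ?_⟩
    · by_cases h : z i = u <;> by_cases h' : z i' = u <;> simp_all
    · rintro (b | b)
      · constructor
        · rintro ⟨h, hne⟩
          obtain ⟨i, rfl⟩ := (hz.2 b).1 h
          refine ⟨i, ?_⟩
          have : z i ≠ u := fun h => hne (by rw [h, Sym2.eq_swap])
          simp [this]
        · rintro ⟨i, hi⟩
          by_cases h : z i = u
          · simp [h] at hi
          · simp only [h, if_false, Sum.inl.injEq] at hi
            subst hi
            exact ⟨hz.adj i, fun h' => h (Sym2.congr_left.1 (Sym2.eq_swap.trans h'))⟩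
      · constructor
        · rintro (⟨h, -⟩ | ⟨-, rfl⟩)
          · exact (huv' h.symm).elim
          · exact ⟨j, by simp [hj]⟩
        · rintro ⟨i, hi⟩
          by_cases h : z i = u
          · simp only [h, if_true, Sum.inr.injEq] at hi
            exact .inr ⟨rfl, hi.symm⟩
          · simp [h] at hi
  · refine ⟨fun i => .inl (z i), fun i i' hii => hz.1 (by simpa using hii), ?_⟩
    rintro (b | b)
    · simp [twoSum, hu, hv, hz.2 b]
    · simp [twoSum, hu, hv]

theorem twoSum_splice (G : SimpleGraph V) (H : SimpleGraph W) {u v : V} {x y : W}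
    (huv : G.Adj u v) : Splice (twoSum G H u v x y) G u v .inl (.inr x) (.inr y) := by
  refine ⟨huv, Sum.inl_injective, fun a b => Iff.rfl, ?_, by simp, by simp⟩
  rintro a (z | z) hz
  · exact (hz ⟨z, rfl⟩).elim
  · simp [twoSum]

theorem twoSum_splice_inr (G : SimpleGraph V) (H : SimpleGraph W) {u v : V} {x y : W}
    (hxy : H.Adj x y) : Splice (twoSum G H u v x y) H x y .inr (.inl u) (.inl v) := by
  refine ⟨hxy, Sum.inr_injective, fun a b => Iff.rfl, ?_, by simp, by simp⟩
  rintro a (z | z) hz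
  · simp [twoSum, and_comm]
  · exact (hz ⟨z, rfl⟩).elim

theorem twoSum_twoEdgeConnected {G : SimpleGraph V} {H : SimpleGraph W}
    (hG : TwoEdgeConnected G) (hH : TwoEdgeConnected H) {u v : V} (huv : u ≠ v) (x y : W) :
    TwoEdgeConnected (twoSum G H u v x y) := by
  intro e f hf
  have hc₁ : s(.inl u, .inr x) ≠ e → f (.inl u) = f (.inr x) := hf _ _ (.inl ⟨rfl, rfl⟩)
  have hc₂ : s(.inl v, .inr y) ≠ e → f (.inl v) = f (.inr y) := hf _ _ (.inr ⟨rfl, rfl⟩)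
  -- The removed edge `uv` is spent as the one exempted edge of `G`.
  have hl : (∀ a b : V, s(.inl a, .inl b) ≠ e) → ∀ a b, f (.inl a) = f (.inl b) := fun he =>
    hG s(u, v) (fun a => f (.inl a)) fun a b hab hne => hf _ _ ⟨hab, hne⟩ (he a b)
  have hr : (∀ a b : W, s(.inr a, .inr b) ≠ e) → ∀ a b, f (.inr a) = f (.inr b) := fun he =>
    hH s(x, y) (fun a => f (.inr a)) fun a b hab hne => hf _ _ ⟨hab, hne⟩ (he a b)
  have fin : ∀ (c : V) (d : W), f (.inl c) = f (.inr d) → (∀ a b, f (.inl a) = f (.inl b)) →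
      (∀ a b, f (.inr a) = f (.inr b)) → ∀ a b, f a = f b := by
    rintro c d h h₁ h₂ (a | a) (b | b)
    · exact h₁ a b
    · rw [h₁ a c, h, h₂ d b]
    · rw [h₂ a d, ← h, h₁ c b]
    · exact h₂ a b
  have cross : ∀ a b, e = s(.inl a, .inr b) → ∀ a b, f a = f b := by
    rintro a b rfl
    have hl := hl (by simp)
    have hr := hr (by simp)
    by_cases h : s(Sum.inl u, Sum.inr x) = s(Sum.inl a, Sum.inr b)
    · by_cases h' : s(Sum.inl v, Sum.inr y) = s(Sum.inl a, Sum.inr b)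
      · simp only [Sym2.eq_iff, Sum.inl.injEq, Sum.inr.injEq, reduceCtorEq, and_self,
          or_false] at h h'
        exact (huv (h.1.trans h'.1.symm)).elim
      · exact fin v y (hc₂ h') hl hr
    · exact fin u x (hc₁ h) hl hr
  induction e with | h a b => ?_
  rcases a with a | a <;> rcases b with b | b
  · have hr := hr (by simp)
    have hc₁ := hc₁ (by simp)
    have hc₂ := hc₂ (by simp)
    refine fin u x hc₁ (hG s(a, b) (fun a => f (.inl a)) fun c d hcd hne => ?_) hr
    by_cases h : s(c, d) = s(u, v)
    -- The detour through the constant right side replaces the removed edge, so the exemption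
    -- remains available for `s(a, b)`.
    · have : f (.inl u) = f (.inl v) := by rw [hc₁, hc₂, hr]
      rcases Sym2.eq_iff.1 h with ⟨rfl, rfl⟩ | ⟨rfl, rfl⟩
      · exact this
      · exact this.symm
    · exact hf _ _ ⟨hcd, h⟩ (by simpa using hne)
  · exact cross a b rfl
  · exact cross b a Sym2.eq_swap
  · have hl := hl (by simp)
    have hc₁ := hc₁ (by simp)
    have hc₂ := hc₂ (by simp)
    refine fin u x hc₁ hl (hH s(a, b) (fun a => f (.inr a)) fun c d hcd hne => ?_)
    by_cases h : s(c, d) = s(x, y)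
    · have : f (.inr x) = f (.inr y) := by rw [← hc₁, ← hc₂, hl]
      rcases Sym2.eq_iff.1 h with ⟨rfl, rfl⟩ | ⟨rfl, rfl⟩
      · exact this
      · exact this.symm
    · exact hf _ _ ⟨hcd, h⟩ (by simpa using hne)

/-- Two cubic graphs are the two sides of a two-edge cut of a third one. -/
theorem exists_twoSum [Finite V] [Finite W] {G : SimpleGraph V} {H : SimpleGraph W}
    (hG : IsCubic₂ G) (hH : IsCubic₂ H) {u v : V} {x y : W} (huv : G.Adj u v) (hxy : H.Adj x y) :
    ∃ (U : Type u) (_ : Finite U) (K : SimpleGraph U) (ι : V → U), IsCubic₂ K ∧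
      (∀ a b, G.Adj a b → s(a, b) ≠ s(u, v) → K.Adj (ι a) (ι b)) ∧
      ∀ M, IsTriple K ∅ M → ∃ M₁ M₂, IsTriple G ∅ M₁ ∧ IsTriple H ∅ M₂ ∧
        (∀ a b, s(a, b) ≠ s(u, v) → freq M₁ a b = freq M (ι a) (ι b)) ∧
        freq M₁ u v = freq M₂ x y := by
  have h₁ := twoSum_splice G H (x := x) (y := y) huv
  have h₂ := twoSum_splice_inr G H (u := u) (v := v) hxy
  refine ⟨V ⊕ W, inferInstance, twoSum G H u v x y, .inl,
    ⟨⟨.inl u⟩, twoSum_twoEdgeConnected hG.conn hH.conn huv.ne x y, ?_⟩,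
    fun a b hab hne => ⟨hab, hne⟩, fun M hM =>
    ⟨_, _, h₁.isTriple hG hM, h₂.isTriple hH hM, fun a b hab => ?_, ?_⟩⟩
  · rintro (p | q)
    · exact twoSum_isPorts_inl G H huv p (hG.ports p)
    · obtain ⟨z, hz⟩ := twoSum_isPorts_inl H G (x := u) (y := v) hxy q (hH.ports q)
      refine ⟨fun i => (z i).swap, fun i j hij => hz.1 ?_, fun t => ?_⟩
      · simpa using congrArg Sum.swap hij
      · rw [← twoSum_swap G H u v x y]
        refine (hz.2 t.swap).trans (exists_congr fun i => ?_)
        exact ⟨fun h => by simp [h], fun h => by simp [← h]⟩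
  · simp only [freq, Splice.unsplice_adj_of_ne hab]
  -- Both sides count the cut edge `ux`.
  · simp only [freq, h₁.unsplice_adj (hM.join _).le, h₂.unsplice_adj (hM.join _).le]
    simp only [SimpleGraph.adj_comm]

end TwoSum

/-! ### The Petersen graph -/

/-- The three neighbours of each vertex of the Petersen graph. -/
def petersenPort : Fin 10 → Fin 3 → Fin 10 :=
  ![![1, 4, 5], ![0, 2, 6], ![1, 3, 7], ![2, 4, 8], ![0, 3, 9], ![0, 7, 8], ![1, 8, 9], ![2, 5, 9],
    ![3, 5, 6], ![4, 6, 7]]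

/-- The Petersen graph. -/
def petersen : SimpleGraph (ULift.{u} (Fin 10)) where
  Adj a b := ∃ i, petersenPort a.down i = b.down
  symm := ⟨by
    have : ∀ a b, (∃ i, petersenPort a i = b) → ∃ i, petersenPort b i = a := by decide
    exact fun a b => this a.down b.down⟩
  loopless := ⟨by
    have : ∀ a, ¬ ∃ i, petersenPort a i = a := by decide
    exact fun a => this a.down⟩

theorem petersen_isPorts (a : ULift.{u} (Fin 10)) :
    IsPorts petersen a fun i => ⟨petersenPort a.down i⟩ := by
  have inj : ∀ a i j, petersenPort a i = petersenPort a j → i = j := by decide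
  refine ⟨fun i j h => inj _ _ _ (congrArg ULift.down h), fun b => exists_congr fun i => ?_⟩
  exact ⟨fun h => ULift.ext _ _ h, fun h => congrArg ULift.down h⟩

theorem petersen_label_const (g : Fin 10 → Bool) (a₀ : Fin 10) (i₀ : Fin 3)
    (h : ∀ a i, s(a, petersenPort a i) ≠ s(a₀, petersenPort a₀ i₀) → g a = g (petersenPort a i)) :
    ∀ a b, g a = g b := by
  -- The order is that of the Hamiltonian path 0, 1, 2, 3, 4, 9, 6, 8, 5, 7.
  have key : g 0 = g 1 ∧ g 1 = g 2 ∧ g 2 = g 3 ∧ g 3 = g 4 ∧ g 4 = g 9 ∧ g 9 = g 6 ∧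
      g 6 = g 8 ∧ g 8 = g 5 ∧ g 5 = g 7 := by
    have e01 : _ → g 0 = g 1 := h 0 0
    have e04 : _ → g 0 = g 4 := h 0 1
    have e05 : _ → g 0 = g 5 := h 0 2
    have e12 : _ → g 1 = g 2 := h 1 1
    have e16 : _ → g 1 = g 6 := h 1 2
    have e23 : _ → g 2 = g 3 := h 2 1
    have e27 : _ → g 2 = g 7 := h 2 2
    have e34 : _ → g 3 = g 4 := h 3 1
    have e38 : _ → g 3 = g 8 := h 3 2
    have e49 : _ → g 4 = g 9 := h 4 2
    have e57 : _ → g 5 = g 7 := h 5 1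
    have e58 : _ → g 5 = g 8 := h 5 2
    have e68 : _ → g 6 = g 8 := h 6 1
    have e69 : _ → g 6 = g 9 := h 6 2
    have e79 : _ → g 7 = g 9 := h 7 2
    clear h
    fin_cases a₀ <;> fin_cases i₀ <;>
      (try replace e01 := e01 (by decide)
       try replace e04 := e04 (by decide)
       try replace e05 := e05 (by decide)
       try replace e12 := e12 (by decide)
       try replace e16 := e16 (by decide)
       try replace e23 := e23 (by decide)
       try replace e27 := e27 (by decide)
       try replace e34 := e34 (by decide)
       try replace e38 := e38 (by decide)
       try replace e49 := e49 (by decide)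
       try replace e57 := e57 (by decide)
       try replace e58 := e58 (by decide)
       try replace e68 := e68 (by decide)
       try replace e69 := e69 (by decide)
       try replace e79 := e79 (by decide)
       grind)
  obtain ⟨h1, h2, h3, h4, h5, h6, h7, h8, h9⟩ := key
  have h0 : ∀ a, g a = g 0 := by
    intro a
    fin_cases a <;> grind
  intro a b
  rw [h0 a, h0 b]

theorem petersen_isCubic₂ : IsCubic₂ petersen.{u} := by
  refine ⟨⟨⟨0⟩⟩, fun e f hf => ?_, fun a => ⟨_, petersen_isPorts a⟩⟩
  suffices h : ∃ a₀ i₀, ∀ a i, s(a, petersenPort a i) ≠ s(a₀, petersenPort a₀ i₀) →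
      s((⟨a⟩ : ULift.{u} (Fin 10)), ⟨petersenPort a i⟩) ≠ e by
    obtain ⟨a₀, i₀, h⟩ := h
    intro x y
    exact petersen_label_const (fun a => f ⟨a⟩) a₀ i₀ (fun a i hai => hf _ _ ⟨i, rfl⟩ (h a i hai))
      x.down y.down
  by_cases he : ∃ a i, s((⟨a⟩ : ULift.{u} (Fin 10)), ⟨petersenPort a i⟩) = e
  · obtain ⟨a₀, i₀, rfl⟩ := he
    exact ⟨a₀, i₀, fun a i h h' => h (by simpa [Sym2.eq_iff] using h')⟩
  -- If `e` is not an edge, any edge may serve as the exempted one.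
  · exact ⟨0, 0, fun a i _ h => he ⟨a, i, h⟩⟩

/-! ### Joins of the Petersen graph -/

/-- Exactly one of three. -/
def oneOf (a b c : Bool) : Prop := a.toNat + b.toNat + c.toNat = 1

/-- An odd number out of three. -/
def oddOf (a b c : Bool) : Prop := (a ^^ b ^^ c) = true

instance (a b c : Bool) : Decidable (oneOf a b c) := inferInstanceAs (Decidable (_ = _))
instance (a b c : Bool) : Decidable (oddOf a b c) := inferInstanceAs (Decidable (_ = _))

/-- The indicator of a join of the Petersen graph with degree one outside `{2, 4, 5, 6}`. -/
structure PetersenJoin (m : Fin 10 → Fin 10 → Bool) : Prop where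
  symm : ∀ a b, m a b = m b a
  odd : ∀ a, oddOf (m a (petersenPort a 0)) (m a (petersenPort a 1)) (m a (petersenPort a 2))
  one : ∀ a ∉ ({2, 4, 5, 6} : Set (Fin 10)),
    oneOf (m a (petersenPort a 0)) (m a (petersenPort a 1)) (m a (petersenPort a 2))

namespace PetersenJoin

variable {m : Fin 10 → Fin 10 → Bool}

/-- Reduces claims about joins to a finite check on the 15 edges. Each vertex condition stands as
soon as its edges are quantified, so that `decide` prunes the search early. -/
theorem elim (h : PetersenJoin m) {C : Bool → Bool → Bool → Bool → Bool → Bool → Bool → Bool →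
      Bool → Bool → Bool → Bool → Bool → Bool → Bool → Prop}
    (hC : ∀ e01 e04 e05, oneOf e01 e04 e05 → ∀ e12 e16, oneOf e01 e12 e16 →
      ∀ e23 e27, oddOf e12 e23 e27 → ∀ e34 e38, oneOf e23 e34 e38 → ∀ e49, oddOf e04 e34 e49 →
      ∀ e57 e79, oneOf e27 e57 e79 → ∀ e69, oneOf e49 e69 e79 → ∀ e58, oddOf e05 e57 e58 →
      ∀ e68, oneOf e38 e58 e68 → oddOf e16 e68 e69 →
      C e01 e04 e05 e12 e16 e23 e27 e34 e38 e49 e57 e58 e68 e69 e79) :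
    C (m 0 1) (m 0 4) (m 0 5) (m 1 2) (m 1 6) (m 2 3) (m 2 7) (m 3 4) (m 3 8) (m 4 9) (m 5 7)
      (m 5 8) (m 6 8) (m 6 9) (m 7 9) := by
  have h0 : oneOf (m 0 1) (m 0 4) (m 0 5) := h.one 0 (by simp)
  have h1 : oneOf (m 0 1) (m 1 2) (m 1 6) := by
    rw [h.symm 0 1]
    exact h.one 1 (by simp)
  have h3 : oneOf (m 2 3) (m 3 4) (m 3 8) := by
    rw [h.symm 2 3]
    exact h.one 3 (by simp)
  have h7 : oneOf (m 2 7) (m 5 7) (m 7 9) := by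
    rw [h.symm 2 7, h.symm 5 7]
    exact h.one 7 (by simp)
  have h8 : oneOf (m 3 8) (m 5 8) (m 6 8) := by
    rw [h.symm 3 8, h.symm 5 8, h.symm 6 8]
    exact h.one 8 (by simp)
  have h9 : oneOf (m 4 9) (m 6 9) (m 7 9) := by
    rw [h.symm 4 9, h.symm 6 9, h.symm 7 9]
    exact h.one 9 (by simp)
  have h2 : oddOf (m 1 2) (m 2 3) (m 2 7) := by
    rw [h.symm 1 2]
    exact h.odd 2
  have h4 : oddOf (m 0 4) (m 3 4) (m 4 9) := by
    rw [h.symm 0 4, h.symm 3 4]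
    exact h.odd 4
  have h5 : oddOf (m 0 5) (m 5 7) (m 5 8) := by
    rw [h.symm 0 5]
    exact h.odd 5
  have h6 : oddOf (m 1 6) (m 6 8) (m 6 9) := by
    rw [h.symm 1 6]
    exact h.odd 6
  exact hC _ _ _ h0 _ _ h1 _ _ h2 _ _ h3 _ h4 _ _ h7 _ h9 _ h5 _ h8 h6

-- Deleting 0 and 1 leaves the octagon 2, 3, 4, 9, 6, 8, 5, 7 with the chords 38 and 79. The two
-- alternatives are the two perfect matchings of the octagon; a chord in the join would force a
-- second edge at 3, 7, 8 or 9.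
set_option synthInstance.maxSize 10000 in
set_option synthInstance.maxHeartbeats 1000000 in
theorem of_mem (h : PetersenJoin m) (h01 : m 0 1 = true) :
    (m 0 4 = false ∧ m 0 5 = false ∧ m 1 2 = false ∧ m 1 6 = false) ∧
    ((m 2 3 = true ∧ m 5 7 = true ∧ m 6 8 = true ∧ m 4 9 = true ∧
      m 2 7 = false ∧ m 5 8 = false ∧ m 6 9 = false ∧ m 3 4 = false) ∨
    (m 2 3 = false ∧ m 5 7 = false ∧ m 6 8 = false ∧ m 4 9 = false ∧
      m 2 7 = true ∧ m 5 8 = true ∧ m 6 9 = true ∧ m 3 4 = true)) :=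
  h.elim (C := fun e01 e04 e05 e12 e16 e23 e27 e34 e38 e49 e57 e58 e68 e69 e79 => e01 = true →
    (e04 = false ∧ e05 = false ∧ e12 = false ∧ e16 = false) ∧
    ((e23 = true ∧ e57 = true ∧ e68 = true ∧ e49 = true ∧
      e27 = false ∧ e58 = false ∧ e69 = false ∧ e34 = false) ∨
    (e23 = false ∧ e57 = false ∧ e68 = false ∧ e49 = false ∧
      e27 = true ∧ e58 = true ∧ e69 = true ∧ e34 = true))) (by decide) h01

-- Exactly one of 04 and 05 is present. If the join avoids these four octagon edges, the first
-- choice leaves no edge at 3, the second none at 8.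
set_option synthInstance.maxSize 10000 in
set_option synthInstance.maxHeartbeats 1000000 in
theorem meets_left (h : PetersenJoin m) (h01 : m 0 1 = false) :
    ¬ (m 2 3 = false ∧ m 5 7 = false ∧ m 6 8 = false ∧ m 4 9 = false) :=
  h.elim (C := fun e01 _ _ _ _ e23 _ _ _ e49 e57 _ e68 _ _ => e01 = false →
    ¬ (e23 = false ∧ e57 = false ∧ e68 = false ∧ e49 = false)) (by decide) h01

-- As for the other octagon matching, with 9 and 7 in the roles of 3 and 8.
set_option synthInstance.maxSize 10000 in
set_option synthInstance.maxHeartbeats 1000000 in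
theorem meets_right (h : PetersenJoin m) (h01 : m 0 1 = false) :
    ¬ (m 2 7 = false ∧ m 5 8 = false ∧ m 6 9 = false ∧ m 3 4 = false) :=
  h.elim (C := fun e01 _ _ _ _ _ e27 e34 _ _ _ e58 _ e69 _ => e01 = false →
    ¬ (e27 = false ∧ e58 = false ∧ e69 = false ∧ e34 = false)) (by decide) h01

-- The join has one spoke at 0 and one at 1. Their outer ends have a common neighbour among 3, 7, 8,
-- 9, where the degree is one, so they cannot both have degree three.
set_option synthInstance.maxSize 10000 in
set_option synthInstance.maxHeartbeats 1000000 in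
theorem of_not_mem (h : PetersenJoin m) (h01 : m 0 1 = false) :
    (m 0 4 = true ∧ m 3 4 = false ∧ m 4 9 = false) ∨
    (m 0 5 = true ∧ m 5 7 = false ∧ m 5 8 = false) ∨
    (m 1 2 = true ∧ m 2 3 = false ∧ m 2 7 = false) ∨
    (m 1 6 = true ∧ m 6 8 = false ∧ m 6 9 = false) :=
  h.elim (C := fun e01 e04 e05 e12 e16 e23 e27 e34 _ e49 e57 e58 e68 e69 _ => e01 = false →
    (e04 = true ∧ e34 = false ∧ e49 = false) ∨ (e05 = true ∧ e57 = false ∧ e58 = false) ∨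
    (e12 = true ∧ e23 = false ∧ e27 = false) ∨ (e16 = true ∧ e68 = false ∧ e69 = false))
    (by decide) h01

/-- Two joins through the edge `01` and a third one not through it. -/
theorem exists_all_one {m₁ m₂ m₃ : Fin 10 → Fin 10 → Bool} (h₁ : PetersenJoin m₁)
    (h₂ : PetersenJoin m₂) (h₃ : PetersenJoin m₃) (h : ∀ a b, (m₁ a b && m₂ a b && m₃ a b) = false)
    (e₁ : m₁ 0 1 = true) (e₂ : m₂ 0 1 = true) (e₃ : m₃ 0 1 = false) :
    ∃ a ∈ ({2, 4, 5, 6} : Set (Fin 10)), ∀ i, oneOf (m₁ a (petersenPort a i))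
      (m₂ a (petersenPort a i)) (m₃ a (petersenPort a i)) := by
  obtain ⟨z₁, c₁⟩ := h₁.of_mem e₁
  obtain ⟨z₂, c₂⟩ := h₂.of_mem e₂
  have key : ∀ a, (m₁ a (petersenPort a 0) = false ∧ m₂ a (petersenPort a 0) = false ∧
      m₃ a (petersenPort a 0) = true) →
      (m₁ a (petersenPort a 1) = !m₂ a (petersenPort a 1) ∧ m₃ a (petersenPort a 1) = false) →
      (m₁ a (petersenPort a 2) = !m₂ a (petersenPort a 2) ∧ m₃ a (petersenPort a 2) = false) →
      ∀ i, oneOf (m₁ a (petersenPort a i)) (m₂ a (petersenPort a i)) (m₃ a (petersenPort a i)) := by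
    rintro a ⟨h, h', h''⟩ ⟨k, k'⟩ ⟨l, l'⟩ i
    fin_cases i
    · simp [h, h', h'', oneOf]
    · simp only [Fin.mk_one, k, k']
      cases m₂ a (petersenPort a 1) <;> rfl
    · simp only [Fin.reduceFinMk, l, l']
      cases m₂ a (petersenPort a 2) <;> rfl
  -- If `m₁` and `m₂` contained the same octagon matching, `m₃` would have to avoid it.
  have opp : (m₁ 2 3 = !m₂ 2 3 ∧ m₁ 5 7 = !m₂ 5 7 ∧ m₁ 6 8 = !m₂ 6 8 ∧ m₁ 4 9 = !m₂ 4 9 ∧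
      m₁ 2 7 = !m₂ 2 7 ∧ m₁ 5 8 = !m₂ 5 8 ∧ m₁ 6 9 = !m₂ 6 9 ∧ m₁ 3 4 = !m₂ 3 4) := by
    rcases c₁ with c₁ | c₁ <;> rcases c₂ with c₂ | c₂
    · refine (h₃.meets_left e₃ ⟨?_, ?_, ?_, ?_⟩).elim
      · simpa [c₁, c₂] using h 2 3
      · simpa [c₁, c₂] using h 5 7
      · simpa [c₁, c₂] using h 6 8
      · simpa [c₁, c₂] using h 4 9
    · simp [c₁, c₂]
    · simp [c₁, c₂]
    · refine (h₃.meets_right e₃ ⟨?_, ?_, ?_, ?_⟩).elim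
      · simpa [c₁, c₂] using h 2 7
      · simpa [c₁, c₂] using h 5 8
      · simpa [c₁, c₂] using h 6 9
      · simpa [c₁, c₂] using h 3 4
  -- At the vertex found, the spoke lies in `m₃` only, and each of the two octagon edges lies in
  -- exactly one of `m₁` and `m₂`.
  rcases h₃.of_not_mem e₃ with c | c | c | c
  · refine ⟨4, by simp, key 4 ?_ ?_ ?_⟩ <;> simp only [petersenPort, Matrix.cons_val] <;>
      (try simp only [h₁.symm 4 0, h₂.symm 4 0, h₃.symm 4 0, h₁.symm 4 3, h₂.symm 4 3, h₃.symm 4 3]) <;>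
      simp [z₁, z₂, c, opp]
  · refine ⟨5, by simp, key 5 ?_ ?_ ?_⟩ <;> simp only [petersenPort, Matrix.cons_val] <;>
      (try simp only [h₁.symm 5 0, h₂.symm 5 0, h₃.symm 5 0]) <;>
      simp [z₁, z₂, c, opp]
  · refine ⟨2, by simp, key 2 ?_ ?_ ?_⟩ <;> simp only [petersenPort, Matrix.cons_val] <;>
      (try simp only [h₁.symm 2 1, h₂.symm 2 1, h₃.symm 2 1]) <;>
      simp [z₁, z₂, c, opp]
  · refine ⟨6, by simp, key 6 ?_ ?_ ?_⟩ <;> simp only [petersenPort, Matrix.cons_val] <;>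
      (try simp only [h₁.symm 6 1, h₂.symm 6 1, h₃.symm 6 1]) <;>
      simp [z₁, z₂, c, opp]

/-- A join through the edge `01` meets every other join. -/
theorem not_disjoint {m₁ m₂ : Fin 10 → Fin 10 → Bool} (h₁ : PetersenJoin m₁)
    (h₂ : PetersenJoin m₂) (h : ∀ a i, (m₁ a (petersenPort a i) && m₂ a (petersenPort a i)) = false)
    (e₁ : m₁ 0 1 = true) : False := by
  have e₂ : m₂ 0 1 = false := by simpa [petersenPort, e₁] using h 0 0
  rcases (h₁.of_mem e₁).2 with c | c
  · refine h₂.meets_left e₂ ⟨?_, ?_, ?_, ?_⟩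
    · simpa [petersenPort, c] using h 2 1
    · simpa [petersenPort, c] using h 5 1
    · simpa [petersenPort, c] using h 6 1
    · simpa [petersenPort, c] using h 4 2
  · refine h₂.meets_right e₂ ⟨?_, ?_, ?_, ?_⟩
    · simpa [petersenPort, c] using h 2 2
    · simpa [petersenPort, c] using h 5 2
    · simpa [petersenPort, c] using h 6 2
    · simpa [petersenPort, c] using h 3 1

end PetersenJoin

/-- The vertices `2`, `4`, `5`, `6` of the Petersen graph: the neighbours of the edge `01`. -/
def petersenSet : Set (ULift.{u} (Fin 10)) := ULift.down ⁻¹' {2, 4, 5, 6}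

open Classical in
theorem IsJoin.petersenJoin {M : SimpleGraph (ULift.{u} (Fin 10))}
    (h : IsJoin petersen petersenSet M) : PetersenJoin fun a b => decide (M.Adj ⟨a⟩ ⟨b⟩) := by
  have e := fun a => (petersen_isPorts a).ncard_neighborSet h.le
  refine ⟨fun a b => by simp only [M.adj_comm], fun a => ?_, fun a ha => ?_⟩
  · have h' := h.odd ⟨a⟩
    rw [e] at h'
    revert h'
    unfold oddOf
    split_ifs <;> simp [*]
  · have h' := h.one ⟨a⟩ ha
    rw [e] at h'
    revert h'
    unfold oneOf
    split_ifs <;> simp [*]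

/-- Frequency one everywhere means pairwise disjoint matchings, but the one through 01 meets every
other. -/
theorem IsTriple.petersen_exists_freq_ne_one {M : Fin 3 → SimpleGraph (ULift.{u} (Fin 10))}
    (hM : IsTriple petersen ∅ M) : ∃ a b, petersen.Adj a b ∧ freq M a b ≠ 1 := by
  classical
  by_contra! hcon
  have hj := fun s => ((hM.join s).mono (Set.empty_subset petersenSet)).petersenJoin
  have hd : ∀ s t, s ≠ t → ∀ a i, (decide ((M s).Adj ⟨a⟩ ⟨petersenPort a i⟩) &&
      decide ((M t).Adj ⟨a⟩ ⟨petersenPort a i⟩)) = false := by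
    intro s t hst a i
    obtain ⟨r, hr⟩ := Set.ncard_eq_one.1 (hcon ⟨a⟩ ⟨petersenPort a i⟩ ⟨i, rfl⟩)
    obtain ⟨-, hr⟩ := Set.eq_singleton_iff_unique_mem.1 hr
    by_contra h
    simp only [Bool.not_eq_false, Bool.and_eq_true, decide_eq_true_eq] at h
    exact hst ((hr s h.1).trans (hr t h.2).symm)
  obtain ⟨s, hs⟩ := Set.ncard_eq_one.1 (hcon ⟨0⟩ ⟨1⟩ ⟨0, rfl⟩)
  obtain ⟨hs, -⟩ := Set.eq_singleton_iff_unique_mem.1 hs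
  obtain ⟨t, ht⟩ := exists_ne s
  exact (hj s).not_disjoint (hj t) (hd s t ht.symm) (decide_eq_true hs)

theorem IsTriple.petersen_exists_all_one {M : Fin 3 → SimpleGraph (ULift.{u} (Fin 10))}
    (hM : IsTriple petersen petersenSet M) (h : freq M ⟨0⟩ ⟨1⟩ = 2) :
    ∃ a ∈ petersenSet, ∀ b, petersen.Adj a b → freq M a b = 1 := by
  classical
  have hj := fun s => (hM.join s).petersenJoin
  have main : ∀ s t r : Fin 3, (∀ a b, freq M a b = (decide ((M s).Adj a b)).toNat +
      (decide ((M t).Adj a b)).toNat + (decide ((M r).Adj a b)).toNat) →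
      (M s).Adj ⟨0⟩ ⟨1⟩ → (M t).Adj ⟨0⟩ ⟨1⟩ → ¬ (M r).Adj ⟨0⟩ ⟨1⟩ →
      ∃ a ∈ petersenSet, ∀ b, petersen.Adj a b → freq M a b = 1 := by
    intro s t r hf hs ht hr
    have hi : ∀ a b : Fin 10, (decide ((M s).Adj ⟨a⟩ ⟨b⟩) && decide ((M t).Adj ⟨a⟩ ⟨b⟩) &&
        decide ((M r).Adj ⟨a⟩ ⟨b⟩)) = false := fun a b => by
      have := hM.freq_le_two ⟨a⟩ ⟨b⟩
      rw [hf] at this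
      revert this
      cases decide ((M s).Adj ⟨a⟩ ⟨b⟩) <;> cases decide ((M t).Adj ⟨a⟩ ⟨b⟩) <;>
        cases decide ((M r).Adj ⟨a⟩ ⟨b⟩) <;> simp
    obtain ⟨a, ha, h'⟩ := (hj s).exists_all_one (hj t) (hj r) hi (decide_eq_true hs)
      (decide_eq_true ht) (decide_eq_false hr)
    refine ⟨⟨a⟩, ha, ?_⟩
    rintro ⟨b⟩ ⟨i, hb⟩
    obtain rfl : petersenPort a i = b := hb
    rw [hf]
    exact h' i
  have hf : ∀ a b, freq M a b = (decide ((M 0).Adj a b)).toNat +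
      (decide ((M 1).Adj a b)).toNat + (decide ((M 2).Adj a b)).toNat := fun a b => by
    rw [freq_eq]
    split_ifs <;> simp [*]
  rw [hf] at h
  by_cases h0 : (M 0).Adj ⟨0⟩ ⟨1⟩ <;> by_cases h1 : (M 1).Adj ⟨0⟩ ⟨1⟩ <;>
    by_cases h2 : (M 2).Adj ⟨0⟩ ⟨1⟩ <;> simp [h0, h1, h2] at h
  · exact main 0 1 2 hf h0 h1 h2
  · exact main 0 2 1 (fun a b => by rw [hf]; ring) h0 h2 h1
  · exact main 1 2 0 (fun a b => by rw [hf]; ring) h1 h2 h0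

/-! ### Prescribing frequencies by planting counterexamples -/

/-- If there is an FR-triple in every bridgeless cubic graph then there is one in which a given edge
has frequency `0`, and one in which it has frequency `2`. -/
theorem exists_freq_eq (hFR : FanRaspaudConjecture.{u}) {f : ℕ} (hf : f = 0 ∨ f = 2) {W : Type u}
    [Finite W] {H : SimpleGraph W} (hH : IsCubic₂ H) {x y : W} (hxy : H.Adj x y) :
    ∃ M, IsTriple H ∅ M ∧ freq M x y = f := by
  by_contra! hcon
  -- Replace the edges listed in `F` one at a time by copies of `H`. `F` may list both orientations
  -- of an edge, which disappear together, hence a bound and not an equality for its size.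
  have key : ∀ (n : ℕ) (V : Type u) [Finite V] (G : SimpleGraph V), IsCubic₂ G →
      ∀ F : Set (V × V), (∀ p ∈ F, G.Adj p.1 p.2) → F.ncard ≤ n →
      ∃ M, IsTriple G ∅ M ∧ ∀ p ∈ F, freq M p.1 p.2 ≠ f := by
    intro n
    induction n with
    | zero =>
      intro V _ G hG F _ hn
      obtain rfl : F = ∅ := (Set.ncard_eq_zero).1 (Nat.le_zero.1 hn)
      obtain ⟨M, hM⟩ := hFR.exists_isTriple hG
      exact ⟨M, hM, by simp⟩
    | succ n ih =>
      intro V _ G hG F hF hn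
      rcases F.eq_empty_or_nonempty with rfl | ⟨⟨u, v⟩, huv⟩
      · obtain ⟨M, hM⟩ := hFR.exists_isTriple hG
        exact ⟨M, hM, by simp⟩
      obtain ⟨U, _, K, ι, hK, hι, hres⟩ := exists_twoSum hG hH (hF _ huv) hxy
      have hlt : {q ∈ F | s(q.1, q.2) ≠ s(u, v)}.ncard < F.ncard :=
        Set.ncard_lt_ncard ⟨fun q hq => hq.1, fun h => (h huv).2 rfl⟩
      obtain ⟨M, hM, hMF⟩ := ih U K hK (Prod.map ι ι '' {q ∈ F | s(q.1, q.2) ≠ s(u, v)})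
        (by
          rintro _ ⟨q, hq, rfl⟩
          exact hι _ _ (hF q hq.1) hq.2)
        ((Set.ncard_image_le).trans (by omega))
      obtain ⟨M₁, M₂, h₁, h₂, hres₁, hres₂⟩ := hres M hM
      refine ⟨M₁, h₁, fun q hq => ?_⟩
      by_cases he : s(q.1, q.2) = s(u, v)
      · have : freq M₁ q.1 q.2 = freq M₁ u v := by
          rcases Sym2.eq_iff.1 he with ⟨e, e'⟩ | ⟨e, e'⟩
          · rw [e, e']
          · rw [e, e', freq_comm]
        rw [this, hres₂]
        exact hcon M₂ h₂
      · rw [hres₁ _ _ he]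
        exact hMF (Prod.map ι ι q) ⟨q, ⟨hq, he⟩, rfl⟩
  obtain ⟨M, hM, hne⟩ := key _ _ petersen petersen_isCubic₂ {q | petersen.Adj q.1 q.2}
    (fun _ h => h) le_rfl
  obtain ⟨a, b, hab, hb⟩ := hM.petersen_exists_freq_ne_one
  have hp := petersen_isPorts a
  have hne' : ∀ i, freq M a ⟨petersenPort a.down i⟩ ≠ f := fun i => hne (_, _) (hp.adj i)
  have hsum := hM.freq_sum (Set.notMem_empty a) hp
  have hle : ∀ i, freq M a ⟨petersenPort a.down i⟩ ≤ 2 := fun i => hM.freq_le_two _ _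
  obtain ⟨i, rfl⟩ := (hp.2 b).1 hab
  have h0 := hle 0
  have h1 := hle 1
  have h2 := hle 2
  have h0' := hne' 0
  have h1' := hne' 1
  have h2' := hne' 2
  -- Three numbers at most 2 with sum 3 that avoid 0, or avoid 2, are all 1.
  fin_cases i <;> simp only [Fin.zero_eta, Fin.mk_one, Fin.reduceFinMk] at hb <;> omega

theorem not_adj_of_freq_eq_zero {V : Type u} {M : Fin 3 → SimpleGraph V} {x y : V}
    (h : freq M x y = 0) (s : Fin 3) : ¬ (M s).Adj x y := fun hs =>
  (Set.eq_empty_iff_forall_notMem.1 ((Set.ncard_eq_zero).1 h)) s hs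

/-- The frequencies `0`, `1`, `2` can be prescribed at a vertex. -/
theorem exists_freq_zero_one_two (hFR : FanRaspaudConjecture.{u}) {V : Type u} [Finite V]
    {G : SimpleGraph V} (hG : IsCubic₂ G) {w : V} {x : Fin 3 → V} (hx : IsPorts G w x) :
    ∃ M, IsTriple G ∅ M ∧ freq M w (x 0) = 0 ∧ freq M w (x 1) = 1 ∧ freq M w (x 2) = 2 := by
  have hy : IsPorts G w (x ∘ Equiv.swap 1 2) :=
    ⟨hx.1.comp (Equiv.injective _), fun u =>
      (hx.2 u).trans ((Equiv.swap 1 2).surjective.exists)⟩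
  obtain ⟨U, _, K, π, ρ, hK, hπ, hρ, -, hcut⟩ := exists_threeSum hG hG hx hy
  obtain ⟨a, b, hab, ha, hb, ha', hb'⟩ := hcut 0
  obtain ⟨M, hM, hM0⟩ := exists_freq_eq hFR (.inl rfl) hK hab
  have hle : ∀ s, M s ≤ K := fun s => (hM.join s).le
  have h₁ := hπ.isTriple hG hM
  have h₂ := hρ.isTriple hG hM
  rw [Set.image_empty, insert_empty_eq] at h₁ h₂
  have f₁ : ∀ a b, K.Adj a b → ∀ i, π a = x i → π b = w →
      freq (fun s => contract π (M s)) w (x i) = freq M a b := fun a b hab i ha hb => by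
    rw [freq_comm, ← ha, ← hb]
    exact hπ.freq_contract hle hab (by rw [ha, hb]; exact (hx.adj i).ne')
  have f₂ : ∀ a b, K.Adj a b → ∀ i, ρ a = w → ρ b = (x ∘ Equiv.swap 1 2) i →
      freq (fun s => contract ρ (M s)) w ((x ∘ Equiv.swap 1 2) i) = freq M a b :=
      fun a b hab i ha hb => by
    rw [← ha, ← hb]
    exact hρ.freq_contract hle hab (by rw [ha, hb]; exact (hy.adj i).ne)
  have f₁₂ : ∀ i, freq (fun s => contract π (M s)) w (x i) =
      freq (fun s => contract ρ (M s)) w ((x ∘ Equiv.swap 1 2) i) := fun i => by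
    obtain ⟨a, b, hab, ha, hb, ha', hb'⟩ := hcut i
    rw [f₁ a b hab i ha hb, f₂ a b hab i ha' hb']
  have h10 := (f₁ a b hab 0 ha hb).trans hM0
  have e0 := f₁₂ 0
  have e1 := f₁₂ 1
  have e2 := f₁₂ 2
  have s0 : Equiv.swap (1 : Fin 3) 2 0 = 0 := by decide
  have s1 : Equiv.swap (1 : Fin 3) 2 1 = 2 := by decide
  have s2 : Equiv.swap (1 : Fin 3) 2 2 = 1 := by decide
  simp only [Function.comp_apply, s0, s1, s2] at e0 e1 e2
  -- The cut edge of frequency 0 rules out degree three at `w`, so both contractions yield perfect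
  -- matchings.
  have t₁ := h₁.of_not_adj hx fun s => ⟨0, not_adj_of_freq_eq_zero h10 s⟩
  have t₂ := h₂.of_not_adj hx fun s => ⟨0, not_adj_of_freq_eq_zero (e0.symm.trans h10) s⟩
  have hsum := t₁.freq_sum (Set.notMem_empty w) hx
  have hl1 := t₁.freq_le_two w (x 1)
  have hl2 := t₁.freq_le_two w (x 2)
  rcases (by omega : freq (fun s => contract π (M s)) w (x 1) = 1 ∨
    freq (fun s => contract π (M s)) w (x 1) = 2) with h | h
  · exact ⟨_, t₁, h10, h, by omega⟩
  · exact ⟨_, t₂, by omega, by omega, by omega⟩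

/-- If all frequencies at `w` are one then no graph in the triple covers all edges at `w`. -/
theorem IsTriple.of_freq_eq_one {V : Type u} {G : SimpleGraph V} {w : V}
    {M : Fin 3 → SimpleGraph V} (hM : IsTriple G {w} M) {x : Fin 3 → V}
    (hx : IsPorts G w x) (h : ∀ i, freq M w (x i) = 1) : IsTriple G ∅ M := by
  classical
  refine hM.of_not_adj hx fun s => ?_
  by_contra! hs
  obtain ⟨t, ht⟩ := exists_ne s
  have hnot : ∀ i, ¬ (M t).Adj w (x i) := fun i hti => by
    obtain ⟨r, hr⟩ := Set.ncard_eq_one.1 (h i)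
    obtain ⟨-, hr⟩ := Set.eq_singleton_iff_unique_mem.1 hr
    exact ht ((hr t hti).trans (hr s (hs i)).symm)
  have hodd := (hM.join t).odd w
  rw [hx.ncard_neighborSet (hM.join t).le, if_neg (hnot 0), if_neg (hnot 1), if_neg (hnot 2)] at hodd
  exact absurd hodd (by decide)

/-- The frequencies `1`, `1`, `1` can be prescribed at a vertex. -/
theorem exists_freq_one (hFR : FanRaspaudConjecture.{u}) {W : Type u} [Finite W]
    {H : SimpleGraph W} (hH : IsCubic₂ H) {w : W} {y : Fin 3 → W} (hy : IsPorts H w y) :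
    ∃ M, IsTriple H ∅ M ∧ ∀ i, freq M w (y i) = 1 := by
  by_contra! hcon
  -- Plant `H` at the vertices of `R` one at a time. Keeping `p` and `q` outside `R` lets the edge
  -- `pq`, with its frequency 2, survive all contractions.
  have key : ∀ (n : ℕ) (V : Type u) [Finite V] (G : SimpleGraph V), IsCubic₂ G →
      ∀ (R : Set V) (p q : V), G.Adj p q → p ∉ R → q ∉ R → R.ncard ≤ n →
      ∃ M, IsTriple G R M ∧ freq M p q = 2 ∧ ∀ v ∈ R, ¬ ∀ b, G.Adj v b → freq M v b = 1 := by
    intro n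
    induction n with
    | zero =>
      intro V _ G hG R p q hpq _ _ hn
      obtain rfl : R = ∅ := (Set.ncard_eq_zero).1 (Nat.le_zero.1 hn)
      obtain ⟨M, hM, hM2⟩ := exists_freq_eq hFR (.inr rfl) hG hpq
      exact ⟨M, hM, hM2, by simp⟩
    | succ n ih =>
      intro V _ G hG R p q hpq hp hq hn
      rcases R.eq_empty_or_nonempty with rfl | ⟨v, hv⟩
      · obtain ⟨M, hM, hM2⟩ := exists_freq_eq hFR (.inr rfl) hG hpq
        exact ⟨M, hM, hM2, by simp⟩
      obtain ⟨x, hx⟩ := hG.ports v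
      obtain ⟨U, _, K, π, ρ, hK, hπ, hρ, hπρ, hcut⟩ := exists_threeSum hG hH hx hy
      obtain ⟨a, b, hab, rfl, rfl⟩ := hπ.lift p q hpq
      have hcard : (π ⁻¹' (R \ {v})).ncard ≤ n := by
        have : (π ⁻¹' (R \ {v})).ncard ≤ (R \ {v}).ncard :=
          Set.ncard_le_ncard_of_injOn π (fun _ h => h) fun c hc d _ hcd => hπ.inj c d hcd hc.2
        rw [Set.ncard_sdiff_singleton_of_mem hv] at this
        omega
      obtain ⟨M, hM, hM2, hMR⟩ := ih U K hK (π ⁻¹' (R \ {v})) a b hab (fun h => hp h.1)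
        (fun h => hq h.1) hcard
      have hle : ∀ s, M s ≤ K := fun s => (hM.join s).le
      have h₁ : IsTriple G R fun s => contract π (M s) := (hπ.isTriple hG hM).mono
        (Set.insert_subset hv (by rintro _ ⟨c, hc, rfl⟩; exact hc.1))
      have h₂ : IsTriple H {w} fun s => contract ρ (M s) := (hρ.isTriple hH hM).mono
        (Set.insert_subset rfl (by rintro _ ⟨c, hc, rfl⟩; exact hπρ c hc.2))
      refine ⟨_, h₁, (hπ.freq_contract hle hab hpq.ne).trans hM2, fun v' hv' h => ?_⟩
      by_cases hvv : v' = v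
      · subst hvv
        -- The edges at `v'` in `G` and at `w` in `H` come from the same cut edges, so their
        -- frequencies agree.
        have hone : ∀ i, freq (fun s => contract ρ (M s)) w (y i) = 1 := fun i => by
          obtain ⟨c, d, hcd, hc, hd, hc', hd'⟩ := hcut i
          rw [← h (x i) (hx.adj i), freq_comm _ v', ← hc, ← hd, ← hc', ← hd',
            hρ.freq_contract hle hcd (by rw [hc', hd']; exact (hy.adj i).ne),
            hπ.freq_contract hle hcd (by rw [hc, hd]; exact (hx.adj i).ne')]
        obtain ⟨i, hi⟩ := hcon _ (h₂.of_freq_eq_one hy hone)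
        exact hi (hone i)
      · obtain ⟨z, hz⟩ := hG.ports v'
        obtain ⟨c, -, -, rfl, -⟩ := hπ.lift v' (z 0) (hz.adj 0)
        refine hMR c ⟨hv', hvv⟩ fun d hcd => ?_
        have hne : π c ≠ π d := fun he => hcd.ne (hπ.inj c d he hvv)
        rw [← hπ.freq_contract hle hcd hne]
        exact h _ (hπ.adj c d hcd hne)
  obtain ⟨M, hM, hM2, hne⟩ := key _ _ petersen petersen_isCubic₂ petersenSet ⟨0⟩ ⟨1⟩ ⟨0, rfl⟩
    (by simp [petersenSet]) (by simp [petersenSet]) le_rfl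
  obtain ⟨a, ha, h⟩ := hM.petersen_exists_all_one hM2
  exact hne a ha h

/-! ### The equivalence -/

theorem IsCubic₂.isPorts {V : Type u} [Finite V] {G : SimpleGraph V} (hG : IsCubic₂ G) {w : V}
    {x : Fin 3 → V} (hx : Function.Injective x) (h : ∀ i, G.Adj w (x i)) : IsPorts G w x := by
  obtain ⟨z, hz⟩ := hG.ports w
  have hsub : Set.range x ⊆ G.neighborSet w := by
    rintro _ ⟨i, rfl⟩
    exact h i
  have heq : Set.range x = G.neighborSet w := by
    refine Set.eq_of_subset_of_ncard_le hsub ?_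
    rw [hz.ncard, ← Set.image_univ, Set.ncard_image_of_injective _ hx]
    simp
  exact ⟨hx, fun u => ⟨fun hu => heq.symm.subset hu, fun hu => heq.subset hu⟩⟩

theorem FanRaspaudConjecture.strong (hFR : FanRaspaudConjecture.{u}) :
    StrongFanRaspaudConjecture.{u} := by
  intro V _ G _ hG w a b c ha hb hc hab hac hbc i j k hi hj hk hijk
  have hG' := isBridgelessCubic_iff.1 hG
  have hinc : ∀ e ∈ G.incidenceSet w, ∃ x, G.Adj w x ∧ e = s(w, x) := by
    rintro e ⟨he, hw⟩
    obtain ⟨x, rfl⟩ := hw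
    exact ⟨x, he, rfl⟩
  obtain ⟨x, hx, rfl⟩ := hinc a ha
  obtain ⟨y, hy, rfl⟩ := hinc b hb
  obtain ⟨z, hz, rfl⟩ := hinc c hc
  have hxy : x ≠ y := fun h => hab (by rw [h])
  have hxz : x ≠ z := fun h => hac (by rw [h])
  have hyz : y ≠ z := fun h => hbc (by rw [h])
  have ports : ∀ x y z, G.Adj w x → G.Adj w y → G.Adj w z → x ≠ y → x ≠ z → y ≠ z →
      IsPorts G w ![x, y, z] := fun x y z hx hy hz hxy hxz hyz => by
    refine hG'.isPorts (fun s t hst => ?_) fun s => ?_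
    · fin_cases s <;> fin_cases t <;> simp_all
    · fin_cases s <;> assumption
  have perm : ∀ x y z, G.Adj w x → G.Adj w y → G.Adj w z → x ≠ y → x ≠ z → y ≠ z →
      ∃ M, IsTriple G ∅ M ∧ freq M w x = 0 ∧ freq M w y = 1 ∧ freq M w z = 2 :=
    fun x y z hx hy hz hxy hxz hyz =>
      exists_freq_zero_one_two hFR hG' (ports x y z hx hy hz hxy hxz hyz)
  suffices h : ∃ M, IsTriple G ∅ M ∧ freq M w x = i ∧ freq M w y = j ∧ freq M w z = k by
    obtain ⟨M, hM, h1, h2, h3⟩ := h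
    obtain ⟨N, hN, hf⟩ := hM.exists_isFRTriple
    exact ⟨N, hN, by rw [hf, h1], by rw [hf, h2], by rw [hf, h3]⟩
  simp only [Set.mem_insert_iff, Set.mem_singleton_iff] at hi hj hk
  -- Seven cases survive: the six orders of 0, 1, 2, and 1, 1, 1.
  rcases hi with rfl | rfl | rfl <;> rcases hj with rfl | rfl | rfl <;>
    rcases hk with rfl | rfl | rfl <;> try omega
  · exact perm x y z hx hy hz hxy hxz hyz
  · obtain ⟨M, hM, h1, h2, h3⟩ := perm x z y hx hz hy hxz hxy hyz.symm
    exact ⟨M, hM, h1, h3, h2⟩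
  · obtain ⟨M, hM, h1, h2, h3⟩ := perm y x z hy hx hz hxy.symm hyz hxz
    exact ⟨M, hM, h2, h1, h3⟩
  · obtain ⟨M, hM, h⟩ := exists_freq_one hFR hG' (ports x y z hx hy hz hxy hxz hyz)
    exact ⟨M, hM, h 0, h 1, h 2⟩
  · obtain ⟨M, hM, h1, h2, h3⟩ := perm z x y hz hx hy hxz.symm hyz.symm hxy
    exact ⟨M, hM, h2, h3, h1⟩
  · obtain ⟨M, hM, h1, h2, h3⟩ := perm y z x hy hz hx hyz hxy.symm hxz.symm
    exact ⟨M, hM, h3, h1, h2⟩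
  · obtain ⟨M, hM, h1, h2, h3⟩ := perm z y x hz hy hx hyz.symm hxz.symm hxy.symm
    exact ⟨M, hM, h3, h2, h1⟩

theorem StrongFanRaspaudConjecture.weak (h : StrongFanRaspaudConjecture.{u}) :
    FanRaspaudConjecture.{u} := by
  intro V _ G _ hG
  have hG' := isBridgelessCubic_iff.1 hG
  obtain ⟨w⟩ := hG'.nonempty
  obtain ⟨x, hx⟩ := hG'.ports w
  have hmem : ∀ i, s(w, x i) ∈ G.incidenceSet w := fun i => ⟨hx.adj i, Sym2.mem_mk_left _ _⟩
  have hne : ∀ i j, i ≠ j → s(w, x i) ≠ s(w, x j) := fun i j hij he =>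
    hij (hx.1 (Sym2.congr_right.1 he))
  obtain ⟨M, hM, -⟩ := h V G hG w _ _ _ (hmem 0) (hmem 1) (hmem 2) (hne 0 1 (by decide))
    (hne 0 2 (by decide)) (hne 1 2 (by decide)) 1 1 1 (by simp) (by simp) (by simp) rfl
  exact ⟨M, hM⟩

end FanRaspaud

theorem mainTheorem1 :
    FanRaspaud.StrongFanRaspaudConjecture.{u} ↔ FanRaspaud.FanRaspaudConjecture.{u} :=
  ⟨fun h => h.weak, fun h => h.strong⟩
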